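/- Let $n\ge 2$, let $\Omega\subset\mathbb R^n$ be a bounded open set, let $a\in L^2(\Omega)$ be real-valued with $a\ge 0$ a.e., and let $\lambda>0$. Let $H^1_0(\Omega)$ be the closure of $C_c^\infty(\Omega)$ in $H^1(\Omega)$. No regularity of $\partial\Omega$ is assumed: $H^{1/2}(\partial\Omega)$ denotes the trace space $H^1(\Omega)/H^1_0(\Omega)$, and $v|_{\partial\Omega}$ denotes the class of $v$ in it. Let $f\in H^{1/2}(\partial\Omega)$, and assume that the weighted least gradient problem $$\min\Big\{\int_\Omega a\,|\nabla v|\,dx \;:\; v\in H^1(\Omega),\ v|_{\partial\Omega}=f\Big\}\qquad (1)$$ has a minimizer. Let $u_f\in H^1(\Omega)$ with $u_f|_{\partial\Omega}=f$ and let $b^0,d^0\in (L^2(\Omega))^n$. For $k=0,1,2,\dots$ the alternating split Bregman algorithm does the following. 1. Let $u^{k+1}\in H^1_0(\Omega)$ be a weak solution of $\Delta u^{k+1}=\nabla\cdot(d^k-b^k)$ in $\Omega$, $u^{k+1}|_{\partial\Omega}=0$. 2. With $w=\nabla u^{k+1}+\nabla u_f+b^k$, let $d^{k+1}=\max\{|w|-\tfrac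 a\lambda,0\}\tfrac{w}{|w|}-\nabla u_f$ where $w\ne0$, and $d^{k+1}=-\nabla u_f$ where $w=0$. 3. Let $b^{k+1}=b^k+\nabla u^{k+1}-d^{k+1}$. Then the algorithm can be carried out (all steps are solvable, with $u^{k+1}\in H^1_0(\Omega)$ and $d^{k+1},b^{k+1}\in(L^2(\Omega))^n$), and for all sequences $b^k,d^k,u^k$ that it produces there are $\hat b,\hat d\in(L^2(\Omega))^n$ and $\hat u\in H^1(\Omega)$ such that * $b^k\rightharpoonup\hat b$ and $d^k\rightharpoonup\hat d$ weakly in $(L^2(\Omega))^n$, and $u^k\rightharpoonup\hat u$ weakly in $H^1(\Omega)$; * $\nabla u^{k+1}-d^k\to0$ strongly in $(L^2(\Omega))^n$, and $\sum_{k=0}^\infty\|\nabla u^{k+1}-d^k\|^2_{L^2}<\infty$; * $\bar u:=\hat u+u_f$ is a minimizer of (1), $\hat d=\nabla\hat u$, and $\nabla\cdot\hat b=0$ in the sense of distributions; * for a.e. $x\in\Omega\setminus\{x:\nabla\bar u(x)=0,\ a(x)\neq0\}$, $$\hat b(x)=\frac1\lambda\, a(x)\frac{\nabla\bar u(x)}{|\nabla\bar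 u(x)|},$$ where the right-hand side is read as $0$ if $a(x)=0$. -/

import Mathlib

open MeasureTheory Filter Topology TopologicalSpace
open scoped Distributions Gradient ContDiff

noncomputable section

namespace LeastGradient

/-- `ℝⁿ` with the Euclidean norm. -/
abbrev Rn (n : ℕ) : Type := EuclideanSpace ℝ (Fin n)

/-- Lebesgue measure on `Ω`. -/
abbrev vol {n : ℕ} (Ω : Opens (Rn n)) : Measure (Rn n) := volume.restrict (Ω : Set (Rn n))

/-- `L²(Ω)`, real-valued. -/
abbrev L2 {n : ℕ} (Ω : Opens (Rn n)) : Type := Lp ℝ 2 (vol Ω)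

/-- `(L²(Ω))ⁿ`, as square integrable vector fields; `‖p‖² = ∫_Ω |p(x)|² dx` with the Euclidean
norm `|·|`. -/
abbrev L2Vec {n : ℕ} (Ω : Opens (Rn n)) : Type := Lp (Rn n) 2 (vol Ω)

section Integrability

variable {n : ℕ} {Ω : Opens (Rn n)}

theorem continuous_gradient (φ : 𝓓(Ω, ℝ)) : Continuous (∇ (φ : Rn n → ℝ)) := by
  unfold gradient
  exact (LinearIsometryEquiv.continuous _).comp (φ.contDiff.continuous_fderiv (by simp))

theorem hasCompactSupport_gradient (φ : 𝓓(Ω, ℝ)) : HasCompactSupport (∇ (φ : Rn n → ℝ)) := by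
  unfold gradient
  exact (φ.hasCompactSupport.fderiv (𝕜 := ℝ)).comp_left (map_zero _)

theorem memLp_gradient (φ : 𝓓(Ω, ℝ)) : MemLp (∇ (φ : Rn n → ℝ)) 2 (vol Ω) :=
  (continuous_gradient φ).memLp_of_hasCompactSupport (hasCompactSupport_gradient φ)

theorem memLp_testFunction (φ : 𝓓(Ω, ℝ)) : MemLp (φ : Rn n → ℝ) 2 (vol Ω) :=
  φ.continuous.memLp_of_hasCompactSupport φ.hasCompactSupport

theorem integrable_smul_gradient (u : L2 Ω) (φ : 𝓓(Ω, ℝ)) :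
    Integrable (fun x => u x • ∇ (φ : Rn n → ℝ) x) (vol Ω) :=
  memLp_one_iff_integrable.1 ((memLp_gradient φ).smul (Lp.memLp u))

theorem integrable_testFunction_smul (g : L2Vec Ω) (φ : 𝓓(Ω, ℝ)) :
    Integrable (fun x => φ x • g x) (vol Ω) :=
  memLp_one_iff_integrable.1 ((Lp.memLp g).smul (memLp_testFunction φ))

end Integrability

/-- `g` is the weak gradient of `u` on `Ω`: `∫_Ω u ∇φ = - ∫_Ω φ g` for all `φ ∈ C_c^∞(Ω)`. -/
def IsWeakGradient {n : ℕ} {Ω : Opens (Rn n)} (u : L2 Ω) (g : L2Vec Ω) : Prop :=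
  ∀ φ : 𝓓(Ω, ℝ), ∫ x, u x • ∇ (φ : Rn n → ℝ) x ∂(vol Ω) = - ∫ x, φ x • g x ∂(vol Ω)

/-- The Sobolev space `H¹(Ω)`, realised as the graph of the weak gradient in
`L²(Ω) × (L²(Ω))ⁿ`: the pairs `(u, ∇u)` with `u ∈ L²(Ω)` whose weak gradient is in `(L²(Ω))ⁿ`
(the weak gradient is determined by `u`). The induced norm is the `H¹` norm
`(‖u‖² + ‖∇u‖²)^{1/2}`. -/
def H1 {n : ℕ} (Ω : Opens (Rn n)) : Submodule ℝ (WithLp 2 (L2 Ω × L2Vec Ω)) where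
  carrier := {w | IsWeakGradient w.fst w.snd}
  zero_mem' := by
    intro φ
    have h1 : (fun x => (0 : L2 Ω) x • ∇ (φ : Rn n → ℝ) x) =ᵐ[vol Ω] fun _ => 0 := by
      filter_upwards [Lp.coeFn_zero ℝ 2 (vol Ω)] with x hx
      rw [hx, Pi.zero_apply, zero_smul]
    have h2 : (fun x => φ x • (0 : L2Vec Ω) x) =ᵐ[vol Ω] fun _ => 0 := by
      filter_upwards [Lp.coeFn_zero (Rn n) 2 (vol Ω)] with x hx
      rw [hx, Pi.zero_apply, smul_zero]
    simp only [WithLp.zero_fst, WithLp.zero_snd]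
    rw [integral_congr_ae h1, integral_congr_ae h2]
    simp
  add_mem' := by
    intro w z hw hz φ
    have h1 : (fun x => (w.fst + z.fst) x • ∇ (φ : Rn n → ℝ) x) =ᵐ[vol Ω]
        fun x => w.fst x • ∇ (φ : Rn n → ℝ) x + z.fst x • ∇ (φ : Rn n → ℝ) x := by
      filter_upwards [Lp.coeFn_add w.fst z.fst] with x hx
      rw [hx, Pi.add_apply, add_smul]
    have h2 : (fun x => φ x • (w.snd + z.snd) x) =ᵐ[vol Ω]
        fun x => φ x • w.snd x + φ x • z.snd x := by
      filter_upwards [Lp.coeFn_add w.snd z.snd] with x hx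
      rw [hx, Pi.add_apply, smul_add]
    simp only [WithLp.add_fst, WithLp.add_snd]
    rw [integral_congr_ae h1, integral_congr_ae h2,
      integral_add (integrable_smul_gradient _ _) (integrable_smul_gradient _ _),
      integral_add (integrable_testFunction_smul _ _) (integrable_testFunction_smul _ _),
      hw φ, hz φ, neg_add]
  smul_mem' := by
    intro c w hw φ
    have h1 : (fun x => (c • w.fst) x • ∇ (φ : Rn n → ℝ) x) =ᵐ[vol Ω]
        fun x => c • (w.fst x • ∇ (φ : Rn n → ℝ) x) := by
      filter_upwards [Lp.coeFn_smul c w.fst] with x hx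
      rw [hx, Pi.smul_apply, smul_assoc]
    have h2 : (fun x => φ x • (c • w.snd) x) =ᵐ[vol Ω] fun x => c • (φ x • w.snd x) := by
      filter_upwards [Lp.coeFn_smul c w.snd] with x hx
      rw [hx, Pi.smul_apply, smul_comm]
    simp only [WithLp.smul_fst, WithLp.smul_snd]
    rw [integral_congr_ae h1, integral_congr_ae h2, integral_smul, integral_smul, hw φ, smul_neg]

/-- The underlying `L²` function of an element of `H¹(Ω)`. -/
def toL2 {n : ℕ} {Ω : Opens (Rn n)} (u : H1 Ω) : L2 Ω := (u : WithLp 2 (L2 Ω × L2Vec Ω)).fst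

/-- The weak gradient `∇u ∈ (L²(Ω))ⁿ` of `u ∈ H¹(Ω)`. -/
def grad {n : ℕ} {Ω : Opens (Rn n)} (u : H1 Ω) : L2Vec Ω :=
  (u : WithLp 2 (L2 Ω × L2Vec Ω)).snd

/-- The elements of `H¹(Ω)` that are given by a test function in `C_c^∞(Ω)`
and its classical gradient. -/
def smoothCompact {n : ℕ} (Ω : Opens (Rn n)) : Set (H1 Ω) :=
  {u | ∃ φ : 𝓓(Ω, ℝ), (∀ᵐ x ∂(vol Ω), toL2 u x = φ x) ∧
    ∀ᵐ x ∂(vol Ω), grad u x = ∇ (φ : Rn n → ℝ) x}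

/-- `H¹₀(Ω)`, the closure of `C_c^∞(Ω)` in `H¹(Ω)` (`C_c^∞(Ω)` is already a linear subspace, so
that taking its span changes nothing). -/
def H10 {n : ℕ} (Ω : Opens (Rn n)) : Submodule ℝ (H1 Ω) :=
  (Submodule.span ℝ (smoothCompact Ω)).topologicalClosure

/-- The space of boundary values `H^{1/2}(∂Ω)` of a bounded open set whose boundary may be
irregular: the trace space `H¹(Ω) / H¹₀(Ω)`. -/
abbrev HHalf {n : ℕ} (Ω : Opens (Rn n)) : Type := H1 Ω ⧸ H10 Ω

/-- The trace `u|_{∂Ω}` of `u ∈ H¹(Ω)`. -/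
def trace {n : ℕ} {Ω : Opens (Rn n)} : H1 Ω →ₗ[ℝ] HHalf Ω := (H10 Ω).mkQ

/-- The distributional divergence `∇ · p` of `p ∈ (L²(Ω))ⁿ`, as a function of the test function:
`⟨∇ · p, φ⟩ = - ∫_Ω p · ∇φ`. -/
def weakDiv {n : ℕ} {Ω : Opens (Rn n)} (p : L2Vec Ω) : 𝓓(Ω, ℝ) → ℝ :=
  fun φ => - ∫ x, inner ℝ (p x) (∇ (φ : Rn n → ℝ) x) ∂(vol Ω)

/-- The weighted total variation `∫_Ω a |∇v|`; the integrand is integrable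
since `a` and `|∇v|` are in `L²(Ω)`. -/
def energy {n : ℕ} {Ω : Opens (Rn n)} (a : L2 Ω) (v : H1 Ω) : ℝ :=
  ∫ x, a x * ‖grad v x‖ ∂(vol Ω)

/-- `v` is a minimizer of `∫_Ω a |∇v|` among all `v ∈ H¹(Ω)` with `v|_{∂Ω} = f`. -/
def IsMinimizer {n : ℕ} {Ω : Opens (Rn n)} (a : L2 Ω) (f : HHalf Ω) (v : H1 Ω) : Prop :=
  trace v = f ∧ ∀ w : H1 Ω, trace w = f → energy a v ≤ energy a w

/-- `max {|w| - t, 0} w / |w|` if `w ≠ 0`, and `0` if `w = 0`. -/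
def shrink {n : ℕ} (t : ℝ) (w : Rn n) : Rn n :=
  if w = 0 then 0 else max (‖w‖ - t) 0 • (‖w‖⁻¹ • w)

/-- `(b, d, u)` is produced by the alternating split Bregman algorithm with parameter `lam`,
weight `a`, extension `uf` of the boundary data, and initial values `b0`, `d0`. The algorithm
produces `u k` for `k ≥ 1` only; nothing is said about `u 0`. -/
structure IsBregmanRun {n : ℕ} {Ω : Opens (Rn n)} (lam : ℝ) (a : L2 Ω) (uf : H1 Ω)
    (b0 d0 : L2Vec Ω) (b d : ℕ → L2Vec Ω) (u : ℕ → H1 Ω) : Prop where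
  init_b : b 0 = b0
  init_d : d 0 = d0
  /-- `Δ u^{k+1} = ∇ · (d^k - b^k)` in `Ω` -/
  poisson : ∀ k, weakDiv (grad (u (k + 1))) = weakDiv (d k - b k)
  /-- `u^{k+1} = 0` on `∂Ω` -/
  boundary : ∀ k, trace (u (k + 1)) = 0
  step_d : ∀ k, ∀ᵐ x ∂(vol Ω), d (k + 1) x =
    shrink (a x / lam) (grad (u (k + 1)) x + grad uf x + b k x) - grad uf x
  step_b : ∀ k, b (k + 1) = b k + grad (u (k + 1)) - d (k + 1)

/-- Weak convergence of a sequence in a real normed space. -/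
def WeakTendsto {X : Type*} [NormedAddCommGroup X] [NormedSpace ℝ X] (s : ℕ → X) (l : X) : Prop :=
  Tendsto (fun k => toWeakSpace ℝ X (s k)) atTop (𝓝 (toWeakSpace ℝ X l))

end LeastGradient

end

/-!
Write `K ⊆ (L²(Ω))ⁿ` for the space of gradients of `H¹₀(Ω)`, `P` for the orthogonal projection onto
`K`, and `J w = shrink (a / lam) (w + ∇uf) - ∇uf`. By the Poincaré inequality
(`exists_norm_toL2_le`) `K` is closed and an element of `H¹₀(Ω)` depends continuously on its
gradient (`exists_gradients_inverse`). The Poisson step says `∇u' = P (d - b)`, since the fields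
that are divergence free in the sense of distributions are those in `Kᗮ` (`weakDiv_eq_zero_iff`),
and the shrinkage step says `d' = J (b + ∇u')`. So the algorithm is the iteration
`d' = J (b + P (d - b))`, `b' = b + P (d - b) - d'` (`isBregmanRun_iff`). Here `J` is the proximal
map of `p ↦ lam⁻¹ ∫ a |p + ∇uf|` (`isProx_shrinkL2`), hence firmly nonexpansive.

Call `(b, d)` a saddle point if `d ∈ K`, `b ∈ Kᗮ` and `J (d + b) = d`, the last condition saying
that `b` is a subgradient at `d`. A minimizer of the least gradient problem gives a saddle point: the
energy is convex and continuous on `(L²(Ω))ⁿ`, so that the Hahn-Banach theorem provides a multiplier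
(`exists_subgradient_mem_orthogonal`). Conversely the `d` of a saddle point is a minimizer over `K`
(`IsSaddle.le_of_mem`).

Relative to a saddle point `(b*, d*)`, each step satisfies (`splitting_step_identity`)
`‖b' - b*‖² + ‖d' - d*‖² + 2 ⟪b' - b*, d' - d*⟫ + ‖P (d - b) - d‖² = ‖b - b*‖² + ‖d - d*‖²`,
and the inner product is nonnegative by monotonicity. Thus the residuals `P (d - b) - d` are square
summable, the distances to all saddle points converge, and the inner products tend to `0`. Since
`‖P (d - b) - d‖² = ‖P b‖² + ‖d - P d‖²`, every weak cluster point has `d ∈ K` and `b ∈ Kᗮ`, and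
since the inner products tend to `0`, monotonicity passes to the limit and every weak cluster point is a
saddle point. Opial's lemma (`exists_weakTendsto_of_tendsto_norm_sub`) in the product Hilbert space
then gives weak convergence of the whole sequence `(b, d)` (`splitting_converges`). The formula for
the limit of `b` is the pointwise form of `J (d + b) = d` (`eq_smul_of_shrink_add_eq`).
-/

noncomputable section

namespace LeastGradient

/-! ### Weak convergence in Hilbert spaces -/

section WeakConvergence

open scoped InnerProductSpace

variable {H : Type*} [NormedAddCommGroup H] [InnerProductSpace ℝ H] [CompleteSpace H]

theorem weakTendsto_iff {X : Type*} [NormedAddCommGroup X] [NormedSpace ℝ X] {s : ℕ → X} {l : X} :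
    WeakTendsto s l ↔ ∀ φ : X →L[ℝ] ℝ, Tendsto (fun k => φ (s k)) atTop (𝓝 (φ l)) := by
  have hinj : Function.Injective (topDualPairing ℝ X).flip := by
    intro x y hxy
    by_contra hne
    obtain ⟨φ, hφ⟩ := SeparatingDual.exists_separating_of_ne (R := ℝ) hne
    exact hφ (LinearMap.congr_fun hxy φ)
  exact WeakBilin.tendsto_iff_forall_eval_tendsto _ hinj

theorem weakTendsto_iff_inner {s : ℕ → H} {l : H} :
    WeakTendsto s l ↔ ∀ y, Tendsto (fun k => inner ℝ (s k) y) atTop (𝓝 (inner ℝ l y)) := by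
  rw [weakTendsto_iff]
  constructor
  · intro h y
    simpa [real_inner_comm] using h (innerSL ℝ y)
  · intro h φ
    have := h ((InnerProductSpace.toDual ℝ H).symm φ)
    simp only [real_inner_comm ((InnerProductSpace.toDual ℝ H).symm φ)] at this
    simpa [InnerProductSpace.toDual_symm_apply, real_inner_comm] using this

theorem WeakTendsto.map {X Y : Type*} [NormedAddCommGroup X] [NormedSpace ℝ X]
    [NormedAddCommGroup Y] [NormedSpace ℝ Y] {s : ℕ → X} {l : X} (h : WeakTendsto s l)
    (T : X →L[ℝ] Y) : WeakTendsto (fun k => T (s k)) (T l) := by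
  rw [weakTendsto_iff] at h ⊢
  exact fun φ => h (φ.comp T)

/-- Weak compactness of balls in a Hilbert space, along an ultrafilter. -/
theorem exists_weak_limit_ultrafilter {ι : Type*} (U : Ultrafilter ι) {z : ι → H} {C : ℝ}
    (hz : ∀ k, ‖z k‖ ≤ C) :
    ∃ l : H, ∀ y, Tendsto (fun k => inner ℝ (z k) y) U (𝓝 (inner ℝ l y)) := by
  let F : ι → WeakDual ℝ H := fun k => StrongDual.toWeakDual (InnerProductSpace.toDual ℝ H (z k))
  have hK := WeakDual.isCompact_closedBall (𝕜 := ℝ) (0 : StrongDual ℝ H) C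
  have hF : ∀ k, F k ∈ WeakDual.toStrongDual ⁻¹' Metric.closedBall (0 : StrongDual ℝ H) C := by
    intro k
    simpa [F] using hz k
  obtain ⟨x, -, hx⟩ := hK.ultrafilter_le_nhds (U.map F)
    (by rw [le_principal_iff]; exact Filter.mem_map.2 (Filter.univ_mem' hF))
  refine ⟨(InnerProductSpace.toDual ℝ H).symm (WeakDual.toStrongDual x), fun y => ?_⟩
  have hx' : Tendsto F U (𝓝 x) := hx
  have h1 :=
    (WeakBilin.tendsto_iff_forall_eval_tendsto _ ContinuousLinearMap.coe_injective).1 hx' y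
  have e : ⟪(InnerProductSpace.toDual ℝ H).symm (WeakDual.toStrongDual x), y⟫_ℝ = x y :=
    InnerProductSpace.toDual_symm_apply
  rw [e]
  exact h1

/-- **Opial's lemma**: if the distances of `z k` to the points of `S` converge and every weak
cluster point of `z` (along an ultrafilter) is in `S`, then `z` converges weakly to a point of
`S`. -/
theorem exists_weakTendsto_of_tendsto_norm_sub {z : ℕ → H} {S : Set H} (hS : S.Nonempty)
    (hdist : ∀ s ∈ S, ∃ L, Tendsto (fun k => ‖z k - s‖ ^ 2) atTop (𝓝 L))
    (hcluster : ∀ (U : Ultrafilter ℕ) (l : H), (U : Filter ℕ) ≤ atTop →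
      (∀ y, Tendsto (fun k => inner ℝ (z k) y) U (𝓝 (inner ℝ l y))) → l ∈ S) :
    ∃ l ∈ S, WeakTendsto z l := by
  obtain ⟨C, hC⟩ : ∃ C, ∀ k, ‖z k‖ ≤ C := by
    obtain ⟨s, hs⟩ := hS
    obtain ⟨L, hL⟩ := hdist s hs
    obtain ⟨B, hB⟩ := hL.bddAbove_range
    refine ⟨(B + 1) + ‖s‖, fun k => ?_⟩
    have h1 : ‖z k - s‖ ^ 2 ≤ B := hB ⟨k, rfl⟩
    have h2 : ‖z k‖ ≤ ‖z k - s‖ + ‖s‖ := by simpa using norm_add_le (z k - s) s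
    nlinarith [norm_nonneg (z k - s), sq_nonneg (‖z k - s‖ - 1)]
  have huniq : ∀ (U V : Ultrafilter ℕ) (l m : H), (U : Filter ℕ) ≤ atTop →
      (V : Filter ℕ) ≤ atTop →
      (∀ y, Tendsto (fun k => inner ℝ (z k) y) U (𝓝 (inner ℝ l y))) →
      (∀ y, Tendsto (fun k => inner ℝ (z k) y) V (𝓝 (inner ℝ m y))) → l = m := by
    intro U V l m hU hV hl hm
    obtain ⟨A, hA⟩ := hdist l (hcluster U l hU hl)
    obtain ⟨B, hB⟩ := hdist m (hcluster V m hV hm)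
    -- `2 ⟪z k, l - m⟫` is a difference of squared distances up to a constant, so it converges
    have hlim : Tendsto (fun k => inner ℝ (z k) (l - m)) atTop
        (𝓝 ((B - A + (‖l‖ ^ 2 - ‖m‖ ^ 2)) / 2)) := by
      refine (((hB.sub hA).add_const _).div_const 2).congr fun k => ?_
      rw [norm_sub_sq_real, norm_sub_sq_real, inner_sub_right]
      ring
    have e1 := tendsto_nhds_unique (hl (l - m)) (hlim.mono_left hU)
    have e2 := tendsto_nhds_unique (hm (l - m)) (hlim.mono_left hV)
    have e3 : inner ℝ (l - m) (l - m) = 0 := by rw [inner_sub_left, e1, e2, sub_self]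
    exact sub_eq_zero.1 (inner_self_eq_zero.1 e3)
  have hU0 : ((Ultrafilter.of atTop : Ultrafilter ℕ) : Filter ℕ) ≤ atTop := Ultrafilter.of_le _
  obtain ⟨l, hl⟩ := exists_weak_limit_ultrafilter (Ultrafilter.of atTop) hC
  refine ⟨l, hcluster _ l hU0 hl, weakTendsto_iff_inner.2 fun y => ?_⟩
  rw [tendsto_iff_ultrafilter]
  intro V hV
  obtain ⟨m, hm⟩ := exists_weak_limit_ultrafilter V hC
  rw [huniq _ V l m hU0 hV hl hm]
  exact hm y

end WeakConvergence

/-! ### The splitting iteration in a Hilbert space -/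

section Splitting

variable {H : Type*} [NormedAddCommGroup H] [InnerProductSpace ℝ H]

/-- `(b, d)` solves the optimality system of the splitting with subspace `K` and resolvent `J`:
`d ∈ K`, `b ⟂ K` and `d = J (d + b)`. If `J` is the proximal map of `g`, the last condition says
that `b` is a subgradient of `g` at `d`. -/
structure IsSaddle (K : Submodule ℝ H) (J : H → H) (b d : H) : Prop where
  mem : d ∈ K
  orth : b ∈ Kᗮ
  fixed : J (d + b) = d

/-- Firm nonexpansiveness of `J`. -/
def FirmlyNonexpansive (J : H → H) : Prop :=
  ∀ w z, 0 ≤ inner ℝ ((w - J w) - (z - J z)) (J w - J z)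

variable {K : Submodule ℝ H} [K.HasOrthogonalProjection] {J : H → H}

theorem norm_sq_starProjection_add (x y : H) :
    ‖K.starProjection x + (y - K.starProjection y)‖ ^ 2 =
      ‖K.starProjection x‖ ^ 2 + ‖y - K.starProjection y‖ ^ 2 := by
  have h : inner ℝ (K.starProjection x) (y - K.starProjection y) = 0 := by
    rw [real_inner_comm]
    exact K.starProjection_inner_eq_zero y _ (K.starProjection_apply_mem x)
  rw [norm_add_sq_real, h]
  ring

theorem norm_sq_eq_starProjection (x : H) :
    ‖x‖ ^ 2 = ‖K.starProjection x‖ ^ 2 + ‖x - K.starProjection x‖ ^ 2 := by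
  rw [← norm_sq_starProjection_add]
  simp

/-- The energy identity behind the convergence of the splitting, for one step
`b' = b + P (d - b) - d'`, where `P` is the projection onto `K`. -/
theorem splitting_energy_identity {b d b' d' : H}
    (hb' : b' = b + K.starProjection (d - b) - d') :
    ‖b'‖ ^ 2 + ‖d'‖ ^ 2 + 2 * inner ℝ b' d' + ‖K.starProjection (d - b) - d‖ ^ 2 =
      ‖b‖ ^ 2 + ‖d‖ ^ 2 := by
  have h1 : b' + d' = K.starProjection d + (b - K.starProjection b) := by
    rw [hb', map_sub]; abel
  have h2 : K.starProjection (d - b) - d =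
      -(K.starProjection b + (d - K.starProjection d)) := by
    rw [map_sub]; abel
  have h3 : ‖b' + d'‖ ^ 2 = ‖b'‖ ^ 2 + ‖d'‖ ^ 2 + 2 * inner ℝ b' d' := by
    rw [norm_add_sq_real]; ring
  rw [← h3, h1, h2, norm_neg, norm_sq_starProjection_add, norm_sq_starProjection_add,
    norm_sq_eq_starProjection (K := K) b, norm_sq_eq_starProjection (K := K) d]
  ring

/-- The residual controls the component of `b` in `K` and the component of `d` in `Kᗮ`. -/
theorem norm_sq_starProjection_sub_sub (b d : H) :
    ‖K.starProjection (d - b) - d‖ ^ 2 =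
      ‖K.starProjection b‖ ^ 2 + ‖d - K.starProjection d‖ ^ 2 := by
  have h2 : K.starProjection (d - b) - d =
      -(K.starProjection b + (d - K.starProjection d)) := by
    rw [map_sub]; abel
  rw [h2, norm_neg, norm_sq_starProjection_add]

theorem mem_of_tendsto_inner {ι : Type*} {U : Filter ι} [U.NeBot] {d : ι → H} {l : H}
    (hl : ∀ y, Tendsto (fun k => inner ℝ (d k) y) U (𝓝 (inner ℝ l y)))
    (h : Tendsto (fun k => d k - K.starProjection (d k)) U (𝓝 0)) : l ∈ K := by
  rw [← K.orthogonal_orthogonal, Submodule.mem_orthogonal']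
  intro y hy
  refine tendsto_nhds_unique (hl y) ?_
  have t : Tendsto (fun k => inner ℝ (d k - K.starProjection (d k)) y) U (𝓝 (inner ℝ 0 y)) :=
    h.inner tendsto_const_nhds
  rw [inner_zero_left] at t
  refine t.congr fun k => ?_
  rw [inner_sub_left, (Submodule.mem_orthogonal _ _).1 hy _ (K.starProjection_apply_mem _),
    sub_zero]

theorem mem_orthogonal_of_tendsto_inner {ι : Type*} {U : Filter ι} [U.NeBot] {b : ι → H} {l : H}
    (hl : ∀ y, Tendsto (fun k => inner ℝ (b k) y) U (𝓝 (inner ℝ l y)))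
    (h : Tendsto (fun k => K.starProjection (b k)) U (𝓝 0)) : l ∈ Kᗮ := by
  rw [Submodule.mem_orthogonal']
  intro y hy
  refine tendsto_nhds_unique (hl y) ?_
  have t : Tendsto (fun k => inner ℝ (K.starProjection (b k)) y) U (𝓝 (inner ℝ 0 y)) :=
    h.inner tendsto_const_nhds
  rw [inner_zero_left] at t
  refine t.congr fun k => ?_
  have := K.starProjection_inner_eq_zero (b k) y hy
  rw [inner_sub_left] at this
  linarith

variable {b d : ℕ → H}

/-- One step of the splitting relative to a saddle point: the squared distance to the saddle point
drops by the squared residual and by twice the monotonicity gap, which is nonnegative when both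
`b'` and the multiplier are subgradients. -/
theorem splitting_step_identity {bs ds : H} (hs : IsSaddle K J bs ds) {b d b' d' : H}
    (hb' : b' = b + K.starProjection (d - b) - d') :
    ‖b' - bs‖ ^ 2 + ‖d' - ds‖ ^ 2 + 2 * inner ℝ (b' - bs) (d' - ds) +
      ‖K.starProjection (d - b) - d‖ ^ 2 = ‖b - bs‖ ^ 2 + ‖d - ds‖ ^ 2 := by
  have hP : K.starProjection ((d - ds) - (b - bs)) = K.starProjection (d - b) - ds := by
    have e1 : K.starProjection ds = ds := K.starProjection_eq_self_iff.2 hs.mem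
    have e2 : K.starProjection bs = 0 := K.starProjection_apply_eq_zero_iff.2 hs.orth
    rw [map_sub, map_sub, map_sub, map_sub, e1, e2]
    abel
  have h := splitting_energy_identity (K := K) (b := b - bs) (d := d - ds) (b' := b' - bs)
    (d' := d' - ds) (by rw [hP, hb']; abel)
  rw [hP, sub_sub_sub_cancel_right] at h
  exact h

/-- The pairs `(b, d)` with `J (d + b) = d` form a monotone relation. -/
theorem FirmlyNonexpansive.inner_nonneg (hJ : FirmlyNonexpansive J) {bs ds b d : H}
    (hs : J (ds + bs) = ds) (h : J (d + b) = d) : 0 ≤ inner ℝ (b - bs) (d - ds) := by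
  have := hJ (d + b) (ds + bs)
  rwa [h, hs, add_sub_cancel_left, add_sub_cancel_left] at this

/-- Weak convergence of the alternating split Bregman (Douglas–Rachford) iteration in a Hilbert
space to a saddle point. The initial pair is arbitrary: only the pairs `(b k, d k)` with `1 ≤ k`
satisfy `J (d k + b k) = d k`. -/
theorem splitting_converges [CompleteSpace H] (hJ : FirmlyNonexpansive J)
    (hsaddle : ∃ bs ds, IsSaddle K J bs ds)
    (hd : ∀ k, d (k + 1) = J (b k + K.starProjection (d k - b k)))
    (hb : ∀ k, b (k + 1) = b k + K.starProjection (d k - b k) - d (k + 1)) :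
    Summable (fun k => ‖K.starProjection (d k - b k) - d k‖ ^ 2) ∧
    ∃ bh dh, IsSaddle K J bh dh ∧ WeakTendsto b bh ∧ WeakTendsto d dh := by
  have hfix : ∀ k, J (d (k + 1) + b (k + 1)) = d (k + 1) := by
    intro k
    rw [hb, add_sub_cancel, ← hd]
  set Φ : H → H → ℕ → ℝ := fun bs ds k => ‖b k - bs‖ ^ 2 + ‖d k - ds‖ ^ 2
  have hΦ0 : ∀ bs ds k, 0 ≤ Φ bs ds k := fun bs ds k => by positivity
  have hstep : ∀ bs ds, IsSaddle K J bs ds → ∀ k,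
      Φ bs ds (k + 1) + 2 * inner ℝ (b (k + 1) - bs) (d (k + 1) - ds) +
        ‖K.starProjection (d k - b k) - d k‖ ^ 2 = Φ bs ds k := fun bs ds hs k =>
    splitting_step_identity hs (hb k)
  have hmono : ∀ bs ds, IsSaddle K J bs ds → ∀ k,
      0 ≤ inner ℝ (b (k + 1) - bs) (d (k + 1) - ds) := fun bs ds hs k =>
    hJ.inner_nonneg hs.fixed (hfix k)
  have hanti : ∀ bs ds, IsSaddle K J bs ds → Antitone (Φ bs ds) := by
    intro bs ds hs
    refine antitone_nat_of_succ_le fun k => ?_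
    nlinarith [hstep bs ds hs k, hmono bs ds hs k,
      sq_nonneg ‖K.starProjection (d k - b k) - d k‖]
  have hconv : ∀ bs ds, IsSaddle K J bs ds → ∃ L, Tendsto (Φ bs ds) atTop (𝓝 L) :=
    fun bs ds hs => ⟨_, tendsto_atTop_ciInf (hanti bs ds hs) ⟨0, by
      rintro _ ⟨k, rfl⟩; exact hΦ0 bs ds k⟩⟩
  obtain ⟨bs, ds, hs⟩ := hsaddle
  have hsum : Summable (fun k => ‖K.starProjection (d k - b k) - d k‖ ^ 2) := by
    refine summable_of_sum_range_le (c := Φ bs ds 0) (fun k => sq_nonneg _) fun N => ?_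
    have : ∑ k ∈ Finset.range N, ‖K.starProjection (d k - b k) - d k‖ ^ 2 ≤
        Φ bs ds 0 - Φ bs ds N := by
      rw [← Finset.sum_range_sub']
      exact Finset.sum_le_sum fun k _ => by linarith [hstep bs ds hs k, hmono bs ds hs k]
    linarith [hΦ0 bs ds N]
  refine ⟨hsum, ?_⟩
  have hres := hsum.tendsto_atTop_zero
  -- strong convergence of the components along `K` and `Kᗮ`
  have hPb : Tendsto (fun k => K.starProjection (b k)) atTop (𝓝 0) := by
    rw [tendsto_zero_iff_norm_tendsto_zero]
    have : Tendsto (fun k => ‖K.starProjection (b k)‖ ^ 2) atTop (𝓝 0) :=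
      squeeze_zero (fun k => sq_nonneg _) (fun k => by
        rw [norm_sq_starProjection_sub_sub]
        linarith [sq_nonneg ‖d k - K.starProjection (d k)‖]) hres
    simpa [Real.sqrt_sq] using this.sqrt
  have hQd : Tendsto (fun k => d k - K.starProjection (d k)) atTop (𝓝 0) := by
    rw [tendsto_zero_iff_norm_tendsto_zero]
    have : Tendsto (fun k => ‖d k - K.starProjection (d k)‖ ^ 2) atTop (𝓝 0) :=
      squeeze_zero (fun k => sq_nonneg _) (fun k => by
        rw [norm_sq_starProjection_sub_sub]
        linarith [sq_nonneg ‖K.starProjection (b k)‖]) hres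
    simpa [Real.sqrt_sq] using this.sqrt
  -- the monotonicity gap tends to zero
  have hgap : Tendsto (fun k => inner ℝ (b k - bs) (d k - ds)) atTop (𝓝 0) := by
    rw [← tendsto_add_atTop_iff_nat 1]
    obtain ⟨L, hL⟩ := hconv bs ds hs
    have h1 : Tendsto (fun k => (Φ bs ds k - Φ bs ds (k + 1) -
        ‖K.starProjection (d k - b k) - d k‖ ^ 2) / 2) atTop (𝓝 ((L - L - 0) / 2)) :=
      ((hL.sub ((tendsto_add_atTop_iff_nat 1).2 hL)).sub hres).div_const 2
    simp only [sub_self, zero_div] at h1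
    exact h1.congr fun k => by linarith [hstep bs ds hs k]
  -- Opial's lemma in the product Hilbert space
  let z : ℕ → WithLp 2 (H × H) := fun k => WithLp.toLp 2 (b k, d k)
  let S : Set (WithLp 2 (H × H)) := {w | IsSaddle K J w.fst w.snd}
  obtain ⟨w, hwS, hw⟩ := exists_weakTendsto_of_tendsto_norm_sub (z := z) (S := S)
    ⟨WithLp.toLp 2 (bs, ds), hs⟩ (by
      intro w hw
      obtain ⟨L, hL⟩ := hconv _ _ hw
      refine ⟨L, hL.congr fun k => ?_⟩
      rw [WithLp.prod_norm_sq_eq_of_L2]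
      rfl) (by
      intro U w hU hw
      have hwb : ∀ y, Tendsto (fun k => inner ℝ (b k) y) U (𝓝 (inner ℝ w.fst y)) := by
        intro y
        simpa [z, WithLp.prod_inner_apply] using hw (WithLp.toLp 2 (y, 0))
      have hwd : ∀ y, Tendsto (fun k => inner ℝ (d k) y) U (𝓝 (inner ℝ w.snd y)) := by
        intro y
        simpa [z, WithLp.prod_inner_apply] using hw (WithLp.toLp 2 (0, y))
      have hmem : w.snd ∈ K :=
        mem_of_tendsto_inner hwd (hQd.mono_left hU)
      have horth : w.fst ∈ Kᗮ :=
        mem_orthogonal_of_tendsto_inner hwb (hPb.mono_left hU)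
      refine ⟨hmem, horth, ?_⟩
      -- test monotonicity against the point `y = J (d + b)` of the graph
      set y := J (w.snd + w.fst) with hy
      have hmon : ∀ k, 0 ≤ inner ℝ (b (k + 1) - (w.snd + w.fst - y)) (d (k + 1) - y) :=
        fun k => hJ.inner_nonneg (by rw [add_sub_cancel]) (hfix k)
      have hev : ∀ᶠ k in (U : Filter ℕ), 0 ≤ inner ℝ (b k - (w.snd + w.fst - y)) (d k - y) := by
        refine hU ?_
        filter_upwards [eventually_ge_atTop 1] with k hk
        obtain ⟨j, rfl⟩ := Nat.exists_eq_add_of_le' hk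
        exact hmon j
      have horth' : ∀ {p q : H}, p ∈ K → q ∈ Kᗮ → inner ℝ q p = 0 := fun hp hq =>
        (Submodule.mem_orthogonal' _ _).1 hq _ hp
      -- the only term that is not weakly continuous, `⟪b k, d k⟫`, is controlled by `hgap`
      have hlim : Tendsto (fun k => inner ℝ (b k - (w.snd + w.fst - y)) (d k - y)) U
          (𝓝 (inner ℝ (w.fst - (w.snd + w.fst - y)) (w.snd - y))) := by
        have t := ((hgap.mono_left hU).add (hwb ds)).add (hwd bs)
        have t' := ((t.sub (hwb y)).sub (hwd (w.snd + w.fst - y))).add_const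
          (inner ℝ (w.snd + w.fst - y) y)
        have t'' := t'.sub_const (inner ℝ bs ds)
        convert t'' using 2 with k
        · simp only [inner_sub_left, inner_sub_right, real_inner_comm]
          ring
        · have z1 := horth' hmem horth
          have z2 := horth' hs.mem horth
          have z3 := horth' hmem hs.orth
          have z4 := horth' hs.mem hs.orth
          rw [real_inner_comm] at z3
          rw [z2, z3, z4]
          simp only [inner_sub_left, inner_sub_right, inner_add_left, inner_add_right]
          rw [real_inner_comm w.snd y, z1, real_inner_comm y w.snd]
          rw [real_inner_comm w.fst w.snd, z1]
          ring
      have hge := ge_of_tendsto hlim hev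
      have hneg : inner ℝ (w.fst - (w.snd + w.fst - y)) (w.snd - y) = -‖w.snd - y‖ ^ 2 := by
        rw [show w.fst - (w.snd + w.fst - y) = -(w.snd - y) by abel, inner_neg_left,
          real_inner_self_eq_norm_sq]
      rw [hneg] at hge
      have : ‖w.snd - y‖ = 0 := by nlinarith [sq_nonneg ‖w.snd - y‖]
      exact (sub_eq_zero.1 (norm_eq_zero.1 this)).symm)
  refine ⟨w.fst, w.snd, hwS, ?_, ?_⟩
  · exact hw.map (WithLp.fstL 2 ℝ H H)
  · exact hw.map (WithLp.sndL 2 ℝ H H)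

end Splitting

/-! ### Sobolev spaces, the Poincaré inequality and the space of gradients -/

section Sobolev

variable {n : ℕ} {Ω : Opens (Rn n)}

theorem differentiable_testFunction (φ : 𝓓(Ω, ℝ)) : Differentiable ℝ (φ : Rn n → ℝ) :=
  φ.contDiff.differentiable (by simp)

theorem testFunction_eq_zero_of_notMem (φ : 𝓓(Ω, ℝ)) {x : Rn n} (hx : x ∉ Ω) : φ x = 0 :=
  image_eq_zero_of_notMem_tsupport fun h => hx (φ.tsupport_subset h)

theorem gradient_testFunction_eq_zero_of_notMem (φ : 𝓓(Ω, ℝ)) {x : Rn n} (hx : x ∉ Ω) :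
    ∇ (φ : Rn n → ℝ) x = 0 := by
  have h : fderiv ℝ (φ : Rn n → ℝ) x = 0 :=
    image_eq_zero_of_notMem_tsupport fun h => hx (φ.tsupport_subset (tsupport_fderiv_subset ℝ h))
  rw [gradient, h, map_zero]

theorem continuous_fderiv_apply (φ : 𝓓(Ω, ℝ)) (v : Rn n) :
    Continuous fun x => fderiv ℝ (φ : Rn n → ℝ) x v :=
  (φ.contDiff.continuous_fderiv (by simp)).clm_apply continuous_const

theorem integral_mul_fderiv_testFunction (φ ψ : 𝓓(Ω, ℝ)) (v : Rn n) :
    ∫ x, φ x * fderiv ℝ (ψ : Rn n → ℝ) x v = - ∫ x, fderiv ℝ (φ : Rn n → ℝ) x v * ψ x :=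
  integral_mul_fderiv_eq_neg_fderiv_mul_of_integrable
    (((continuous_fderiv_apply φ v).mul ψ.continuous).integrable_of_hasCompactSupport
      ψ.hasCompactSupport.mul_left)
    ((φ.continuous.mul (continuous_fderiv_apply ψ v)).integrable_of_hasCompactSupport
      φ.hasCompactSupport.mul_right)
    ((φ.continuous.mul ψ.continuous).integrable_of_hasCompactSupport φ.hasCompactSupport.mul_right)
    (fun x _ => differentiable_testFunction φ x) (fun x _ => differentiable_testFunction ψ x)

/-- The classical gradient of a test function is its weak gradient, by integration by parts. -/
theorem isWeakGradient_testFunction (φ : 𝓓(Ω, ℝ)) :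
    IsWeakGradient ((memLp_testFunction φ).toLp φ) ((memLp_gradient φ).toLp _) := by
  intro ψ
  have h1 : ∫ x, (memLp_testFunction φ).toLp φ x • ∇ (ψ : Rn n → ℝ) x ∂(vol Ω) =
      ∫ x, φ x • ∇ (ψ : Rn n → ℝ) x := by
    rw [← setIntegral_eq_integral_of_forall_compl_eq_zero (s := (Ω : Set (Rn n)))
      (f := fun x => φ x • ∇ (ψ : Rn n → ℝ) x)
      (fun x hx => by rw [testFunction_eq_zero_of_notMem φ hx, zero_smul])]
    refine integral_congr_ae ?_
    filter_upwards [(memLp_testFunction φ).coeFn_toLp] with x hx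
    rw [hx]
  have h2 : ∫ x, ψ x • (memLp_gradient φ).toLp _ x ∂(vol Ω) =
      ∫ x, ψ x • ∇ (φ : Rn n → ℝ) x := by
    rw [← setIntegral_eq_integral_of_forall_compl_eq_zero (s := (Ω : Set (Rn n)))
      (f := fun x => ψ x • ∇ (φ : Rn n → ℝ) x)
      (fun x hx => by rw [testFunction_eq_zero_of_notMem ψ hx, zero_smul])]
    refine integral_congr_ae ?_
    filter_upwards [(memLp_gradient φ).coeFn_toLp] with x hx
    rw [hx]
  have i1 : ∀ φ ψ : 𝓓(Ω, ℝ), Integrable fun x => φ x • ∇ (ψ : Rn n → ℝ) x := fun φ ψ =>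
    (φ.continuous.smul (continuous_gradient ψ)).integrable_of_hasCompactSupport
      φ.hasCompactSupport.smul_right
  rw [h1, h2]
  refine ext_inner_left ℝ fun v => ?_
  rw [inner_neg_right, ← integral_inner (i1 φ ψ), ← integral_inner (i1 ψ φ)]
  simpa [inner_smul_right, mul_comm] using integral_mul_fderiv_testFunction φ ψ v

/-- A test function as an element of `H¹(Ω)`. -/
def ofTestFunction (φ : 𝓓(Ω, ℝ)) : H1 Ω :=
  ⟨WithLp.toLp 2 ((memLp_testFunction φ).toLp φ, (memLp_gradient φ).toLp _),
    isWeakGradient_testFunction φ⟩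

theorem coeFn_toL2_ofTestFunction (φ : 𝓓(Ω, ℝ)) : toL2 (ofTestFunction φ) =ᵐ[vol Ω] φ :=
  (memLp_testFunction φ).coeFn_toLp

theorem coeFn_grad_ofTestFunction (φ : 𝓓(Ω, ℝ)) :
    grad (ofTestFunction φ) =ᵐ[vol Ω] ∇ (φ : Rn n → ℝ) :=
  (memLp_gradient φ).coeFn_toLp

theorem mem_smoothCompact_iff {u : H1 Ω} : u ∈ smoothCompact Ω ↔ ∃ φ, u = ofTestFunction φ := by
  constructor
  · rintro ⟨φ, h1, h2⟩
    refine ⟨φ, Subtype.ext ((WithLp.equiv 2 _).injective (Prod.ext ?_ ?_))⟩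
    · exact Lp.ext (Filter.EventuallyEq.trans h1 (coeFn_toL2_ofTestFunction φ).symm)
    · exact Lp.ext (Filter.EventuallyEq.trans h2 (coeFn_grad_ofTestFunction φ).symm)
  · rintro ⟨φ, rfl⟩
    exact ⟨φ, coeFn_toL2_ofTestFunction φ, coeFn_grad_ofTestFunction φ⟩

theorem ofTestFunction_mem_H10 (φ : 𝓓(Ω, ℝ)) : ofTestFunction φ ∈ H10 Ω :=
  Submodule.le_topologicalClosure _ (Submodule.subset_span (mem_smoothCompact_iff.2 ⟨φ, rfl⟩))

theorem gradient_add_testFunction (φ ψ : 𝓓(Ω, ℝ)) (x : Rn n) :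
    ∇ ((φ + ψ : 𝓓(Ω, ℝ)) : Rn n → ℝ) x = ∇ (φ : Rn n → ℝ) x + ∇ (ψ : Rn n → ℝ) x := by
  have h : ((φ + ψ : 𝓓(Ω, ℝ)) : Rn n → ℝ) = φ + ψ := rfl
  rw [h, gradient, gradient, gradient, fderiv_add (differentiable_testFunction φ x)
    (differentiable_testFunction ψ x), map_add]

theorem gradient_smul_testFunction (c : ℝ) (φ : 𝓓(Ω, ℝ)) (x : Rn n) :
    ∇ ((c • φ : 𝓓(Ω, ℝ)) : Rn n → ℝ) x = c • ∇ (φ : Rn n → ℝ) x := by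
  have h : ((c • φ : 𝓓(Ω, ℝ)) : Rn n → ℝ) = c • (φ : Rn n → ℝ) := rfl
  rw [h, gradient, gradient, fderiv_const_smul (differentiable_testFunction φ x), map_smulₛₗ]
  rfl

/-- `C_c^∞(Ω)` is a linear subspace of `H¹(Ω)`. -/
theorem mem_span_smoothCompact_iff {u : H1 Ω} :
    u ∈ Submodule.span ℝ (smoothCompact Ω) ↔ ∃ φ, u = ofTestFunction φ := by
  rw [← mem_smoothCompact_iff]
  refine ⟨fun h => ?_, fun h => Submodule.subset_span h⟩
  induction h using Submodule.span_induction with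
  | mem x h => exact h
  | zero =>
    refine ⟨0, ?_, ?_⟩
    · exact Lp.coeFn_zero ℝ 2 (vol Ω)
    · filter_upwards [Lp.coeFn_zero (Rn n) 2 (vol Ω)] with x hx
      have h0 : ∇ ((0 : 𝓓(Ω, ℝ)) : Rn n → ℝ) x = 0 := gradient_const x 0
      rw [h0]
      exact hx
  | add x y _ _ hx hy =>
    obtain ⟨φ, h1, h2⟩ := hx
    obtain ⟨ψ, h3, h4⟩ := hy
    refine ⟨φ + ψ, ?_, ?_⟩
    · filter_upwards [h1, h3, Lp.coeFn_add (toL2 x) (toL2 y)] with t e1 e2 e3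
      exact e3.trans (congrArg₂ (· + ·) e1 e2)
    · filter_upwards [h2, h4, Lp.coeFn_add (grad x) (grad y)] with t e1 e2 e3
      rw [gradient_add_testFunction, ← e1, ← e2]
      exact e3
  | smul c x _ hx =>
    obtain ⟨φ, h1, h2⟩ := hx
    refine ⟨c • φ, ?_, ?_⟩
    · filter_upwards [h1, Lp.coeFn_smul c (toL2 x)] with t e1 e3
      exact e3.trans (congrArg (c * ·) e1)
    · filter_upwards [h2, Lp.coeFn_smul c (grad x)] with t e1 e3
      rw [gradient_smul_testFunction, ← e1]
      exact e3

/-- The weak gradient as a continuous linear map `H¹(Ω) → (L²(Ω))ⁿ`. -/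
def gradL (Ω : Opens (Rn n)) : H1 Ω →L[ℝ] L2Vec Ω :=
  (WithLp.sndL 2 ℝ (L2 Ω) (L2Vec Ω)).comp (H1 Ω).subtypeL

theorem gradL_apply (u : H1 Ω) : gradL Ω u = grad u := rfl

/-- The inclusion `H¹(Ω) → L²(Ω)` as a continuous linear map. -/
def toL2L (Ω : Opens (Rn n)) : H1 Ω →L[ℝ] L2 Ω :=
  (WithLp.fstL 2 ℝ (L2 Ω) (L2Vec Ω)).comp (H1 Ω).subtypeL

theorem norm_sq_H1 (u : H1 Ω) : ‖u‖ ^ 2 = ‖toL2 u‖ ^ 2 + ‖grad u‖ ^ 2 :=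
  WithLp.prod_norm_sq_eq_of_L2 (u : WithLp 2 (L2 Ω × L2Vec Ω))

theorem memLp_testFunction_smul (φ : 𝓓(Ω, ℝ)) (v : Rn n) :
    MemLp (fun x => φ x • v) 2 (vol Ω) :=
  (φ.continuous.smul continuous_const).memLp_of_hasCompactSupport φ.hasCompactSupport.smul_right

theorem inner_integral_smul_gradient (u : L2 Ω) (φ : 𝓓(Ω, ℝ)) (v : Rn n) :
    inner ℝ v (∫ x, u x • ∇ (φ : Rn n → ℝ) x ∂(vol Ω)) =
      inner ℝ (((memLp_gradient φ).const_inner (𝕜 := ℝ) v).toLp _) u := by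
  rw [← integral_inner (integrable_smul_gradient u φ), L2.inner_def]
  refine integral_congr_ae ?_
  filter_upwards [((memLp_gradient φ).const_inner (𝕜 := ℝ) v).coeFn_toLp] with x hx
  rw [hx, inner_smul_right]
  rfl

theorem inner_integral_testFunction_smul (g : L2Vec Ω) (φ : 𝓓(Ω, ℝ)) (v : Rn n) :
    inner ℝ v (∫ x, φ x • g x ∂(vol Ω)) =
      inner ℝ ((memLp_testFunction_smul φ v).toLp _) g := by
  rw [← integral_inner (integrable_testFunction_smul g φ), L2.inner_def]
  refine integral_congr_ae ?_
  filter_upwards [(memLp_testFunction_smul φ v).coeFn_toLp] with x hx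
  rw [hx, inner_smul_right, real_inner_smul_left]

/-- `H¹(Ω)` is closed in `L²(Ω) × (L²(Ω))ⁿ`, hence complete: tested against a vector `v`, the
definition of the weak gradient is an equality of `L²` inner products. -/
theorem isClosed_H1 : IsClosed (H1 Ω : Set (WithLp 2 (L2 Ω × L2Vec Ω))) := by
  have h : (H1 Ω : Set (WithLp 2 (L2 Ω × L2Vec Ω))) = ⋂ (φ : 𝓓(Ω, ℝ)) (v : Rn n),
      {w | inner ℝ (((memLp_gradient φ).const_inner (𝕜 := ℝ) v).toLp _) (WithLp.fstL 2 ℝ _ _ w) =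
        - inner ℝ ((memLp_testFunction_smul φ v).toLp _) (WithLp.sndL 2 ℝ _ _ w)} := by
    ext w
    simp only [Set.mem_iInter, Set.mem_ofPred_eq]
    refine ⟨fun hw φ v => ?_, fun hw φ => ext_inner_left ℝ fun v => ?_⟩
    · have := congrArg (inner ℝ v) (hw φ)
      rwa [inner_neg_right, inner_integral_smul_gradient, inner_integral_testFunction_smul] at this
    · rw [inner_neg_right, inner_integral_smul_gradient, inner_integral_testFunction_smul]
      exact hw φ v
  rw [h]
  refine isClosed_iInter fun φ => isClosed_iInter fun v => isClosed_eq ?_ ?_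
  · exact continuous_const.inner (WithLp.fstL 2 ℝ _ _).continuous
  · exact (continuous_const.inner (WithLp.sndL 2 ℝ _ _).continuous).neg

instance : CompleteSpace (H1 Ω) := isClosed_H1.completeSpace_coe

/-- **Poincaré inequality** for test functions, with constant twice the radius of a ball around
the origin that contains `Ω`. -/
theorem integral_sq_testFunction_le {v : Rn n} (hv : ‖v‖ = 1) {R : ℝ} (hR : ∀ x ∈ Ω, ‖x‖ ≤ R)
    (φ : 𝓓(Ω, ℝ)) :
    ∫ x, φ x ^ 2 ≤ 4 * R ^ 2 * ∫ x, ‖∇ (φ : Rn n → ℝ) x‖ ^ 2 := by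
  have hφ := differentiable_testFunction φ
  have hd : ∀ x, fderiv ℝ (fun y => φ y * φ y) x v =
      2 * (φ x * fderiv ℝ (φ : Rn n → ℝ) x v) := by
    intro x
    have : fderiv ℝ (fun y => φ y * φ y) x = _ := fderiv_fun_mul (hφ x) (hφ x)
    rw [this]
    simp only [add_apply, smul_apply, smul_eq_mul]
    ring
  have hl : ∀ x, fderiv ℝ (fun y => inner ℝ v y) x v = 1 := by
    intro x
    have : fderiv ℝ (fun y => inner ℝ v y) x = innerSL ℝ v := (innerSL ℝ v).fderiv
    rw [this, innerSL_apply_apply, real_inner_self_eq_norm_sq, hv, one_pow]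
  have hsupp : HasCompactSupport fun x => φ x * φ x := φ.hasCompactSupport.mul_right
  have hcl : Continuous fun x : Rn n => inner ℝ v x := continuous_const.inner continuous_id
  have i0 : Integrable fun x => φ x * φ x :=
    (φ.continuous.mul φ.continuous).integrable_of_hasCompactSupport hsupp
  have i3 : Integrable fun x => inner ℝ v x * (2 * (φ x * fderiv ℝ (φ : Rn n → ℝ) x v)) :=
    (hcl.mul (continuous_const.mul (φ.continuous.mul
      (continuous_fderiv_apply φ v)))).integrable_of_hasCompactSupport
      (HasCompactSupport.mul_left (HasCompactSupport.mul_left φ.hasCompactSupport.mul_right))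
  -- `∫ φ² = ∫ (∂ᵥ ⟪v, x⟫) φ² = - 2 ∫ ⟪v, x⟫ φ ∂ᵥφ`
  have key : ∫ x, φ x ^ 2 =
      - ∫ x, inner ℝ v x * (2 * (φ x * fderiv ℝ (φ : Rn n → ℝ) x v)) := by
    have h := integral_mul_fderiv_eq_neg_fderiv_mul_of_integrable (μ := volume) (v := v)
      (f := fun x : Rn n => inner ℝ v x) (g := fun x => φ x * φ x)
      (by simp only [hl, one_mul]; exact i0)
      (by
        simp only [hd]
        exact i3)
      ((hcl.mul (φ.continuous.mul φ.continuous)).integrable_of_hasCompactSupport hsupp.mul_left)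
      (fun x _ => (innerSL ℝ v).differentiableAt) (fun x _ => (hφ x).mul (hφ x))
    simp only [hd, hl, one_mul] at h
    rw [h, neg_neg]
    simp only [sq]
  have i1 : Integrable fun x => φ x ^ 2 := by
    simp only [sq]
    exact i0
  have hg : HasCompactSupport fun x => ‖∇ (φ : Rn n → ℝ) x‖ ^ 2 :=
    (hasCompactSupport_gradient φ).comp_left (g := fun y : Rn n => ‖y‖ ^ 2) (by simp)
  have hgc : Continuous fun x => ‖∇ (φ : Rn n → ℝ) x‖ ^ 2 := (continuous_gradient φ).norm.pow 2
  have i2 : Integrable fun x => ‖∇ (φ : Rn n → ℝ) x‖ ^ 2 :=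
    hgc.integrable_of_hasCompactSupport hg
  have hpt : ∀ x, -(inner ℝ v x * (2 * (φ x * fderiv ℝ (φ : Rn n → ℝ) x v))) ≤
      1 / 2 * φ x ^ 2 + 2 * R ^ 2 * ‖∇ (φ : Rn n → ℝ) x‖ ^ 2 := by
    intro x
    by_cases hx : x ∈ Ω
    · have hR0 : 0 ≤ R := (norm_nonneg x).trans (hR x hx)
      have b1 : |inner ℝ v x| ≤ R := by
        have := abs_real_inner_le_norm v x
        rw [hv, one_mul] at this
        exact this.trans (hR x hx)
      have b2 : |fderiv ℝ (φ : Rn n → ℝ) x v| ≤ ‖∇ (φ : Rn n → ℝ) x‖ := by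
        rw [← inner_gradient_left (𝕜 := ℝ)]
        simpa [hv] using abs_real_inner_le_norm (∇ (φ : Rn n → ℝ) x) v
      have b3 : |inner ℝ v x * fderiv ℝ (φ : Rn n → ℝ) x v| ≤ R * ‖∇ (φ : Rn n → ℝ) x‖ := by
        rw [abs_mul]
        exact mul_le_mul b1 b2 (abs_nonneg _) hR0
      have b4 := sq_le_sq' (neg_le_of_abs_le b3) (le_of_abs_le b3)
      -- `- 2 s φ ≤ φ² / 2 + 2 s²` with `s = ⟪v, x⟫ ∂ᵥφ`
      nlinarith [sq_nonneg (φ x + 2 * (inner ℝ v x * fderiv ℝ (φ : Rn n → ℝ) x v))]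
    · rw [testFunction_eq_zero_of_notMem φ hx, zero_mul, mul_zero, mul_zero, neg_zero]
      positivity
  have : ∫ x, φ x ^ 2 ≤ 1 / 2 * (∫ x, φ x ^ 2) + 2 * R ^ 2 * ∫ x, ‖∇ (φ : Rn n → ℝ) x‖ ^ 2 := by
    calc ∫ x, φ x ^ 2 = ∫ x, -(inner ℝ v x * (2 * (φ x * fderiv ℝ (φ : Rn n → ℝ) x v))) := by
          rw [key, integral_neg]
      _ ≤ ∫ x, (1 / 2 * φ x ^ 2 + 2 * R ^ 2 * ‖∇ (φ : Rn n → ℝ) x‖ ^ 2) := by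
          exact integral_mono i3.neg ((i1.const_mul _).add (i2.const_mul _)) hpt
      _ = _ := by
          rw [integral_add (i1.const_mul _) (i2.const_mul _), integral_const_mul,
            integral_const_mul]
  linarith

theorem norm_sq_L2_eq {E : Type*} [NormedAddCommGroup E] [InnerProductSpace ℝ E]
    {X : Type*} [MeasurableSpace X] {μ : Measure X} (p : Lp E 2 μ) :
    ‖p‖ ^ 2 = ∫ x, ‖p x‖ ^ 2 ∂μ := by
  rw [← real_inner_self_eq_norm_sq, L2.inner_def]
  simp only [real_inner_self_eq_norm_sq]

/-- **Poincaré inequality** on `H¹₀(Ω)` for bounded `Ω`. -/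
theorem exists_norm_toL2_le (hn : n ≠ 0) (hΩ : Bornology.IsBounded (Ω : Set (Rn n))) :
    ∃ C : ℝ, 0 ≤ C ∧ ∀ u ∈ H10 Ω, ‖toL2 u‖ ≤ C * ‖grad u‖ := by
  obtain ⟨R, hR0, hR⟩ := hΩ.exists_pos_norm_le
  have hR0 := hR0.le
  refine ⟨2 * R, by positivity, fun u hu => ?_⟩
  -- the inequality passes to the closure of the test functions
  have hcl : IsClosed {u : H1 Ω | ‖toL2L Ω u‖ ≤ 2 * R * ‖gradL Ω u‖} :=
    isClosed_le (toL2L Ω).continuous.norm (continuous_const.mul (gradL Ω).continuous.norm)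
  refine closure_minimal ?_ hcl hu
  intro w hw
  obtain ⟨φ, rfl⟩ := mem_span_smoothCompact_iff.1 hw
  let v : Rn n := EuclideanSpace.single ⟨0, Nat.pos_of_ne_zero hn⟩ 1
  have hv : ‖v‖ = 1 := by simp [v]
  have h := integral_sq_testFunction_le hv hR φ
  have h1 : ‖toL2 (ofTestFunction φ)‖ ^ 2 = ∫ x, φ x ^ 2 := by
    rw [norm_sq_L2_eq, ← setIntegral_eq_integral_of_forall_compl_eq_zero (s := (Ω : Set (Rn n)))
      (f := fun x => φ x ^ 2)
      (fun x hx => by rw [testFunction_eq_zero_of_notMem φ hx, zero_pow two_ne_zero])]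
    refine integral_congr_ae ?_
    filter_upwards [coeFn_toL2_ofTestFunction φ] with x hx
    rw [hx, Real.norm_eq_abs, sq_abs]
  have h2 : ‖grad (ofTestFunction φ)‖ ^ 2 = ∫ x, ‖∇ (φ : Rn n → ℝ) x‖ ^ 2 := by
    rw [norm_sq_L2_eq, ← setIntegral_eq_integral_of_forall_compl_eq_zero (s := (Ω : Set (Rn n)))
      (f := fun x => ‖∇ (φ : Rn n → ℝ) x‖ ^ 2)
      (fun x hx => by
        rw [gradient_testFunction_eq_zero_of_notMem φ hx, norm_zero, zero_pow two_ne_zero])]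
    refine integral_congr_ae ?_
    filter_upwards [coeFn_grad_ofTestFunction φ] with x hx
    rw [hx]
  rw [← h1, ← h2] at h
  refine le_of_sq_le_sq (a := ‖toL2 (ofTestFunction φ)‖)
    (b := 2 * R * ‖grad (ofTestFunction φ)‖) ?_ (by positivity)
  linarith [mul_pow (2 * R) ‖grad (ofTestFunction φ)‖ 2, mul_pow 2 R 2]

/-- A continuous linear map that is bounded below on a closed subspace of a Banach space has
closed image there, and a continuous inverse. -/
theorem exists_inverse_of_bounded_below {E F : Type*} [NormedAddCommGroup E] [NormedSpace ℝ E]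
    [CompleteSpace E] [NormedAddCommGroup F] [NormedSpace ℝ F] [CompleteSpace F]
    {S : Submodule ℝ E} (hS : IsClosed (S : Set E)) (L : E →L[ℝ] F) {C : ℝ} (hC0 : 0 ≤ C)
    (hC : ∀ u ∈ S, ‖u‖ ≤ C * ‖L u‖) :
    IsClosed (S.map (L : E →ₗ[ℝ] F) : Set F) ∧ ∃ T : S.map (L : E →ₗ[ℝ] F) →L[ℝ] E,
      ∀ u ∈ S, ∀ h : L u ∈ S.map (L : E →ₗ[ℝ] F), T ⟨L u, h⟩ = u := by
  have : CompleteSpace S := hS.completeSpace_coe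
  let G : S →L[ℝ] F := L.comp S.subtypeL
  have hG : AntilipschitzWith C.toNNReal G :=
    ContinuousLinearMap.antilipschitz_of_bound _ fun u => by
      rw [Real.coe_toNNReal _ hC0]
      exact hC u u.2
  have hcl : IsClosed (Set.range G) := hG.isClosed_range G.uniformContinuous
  have hrange : (S.map (L : E →ₗ[ℝ] F)) = LinearMap.range (G : S →ₗ[ℝ] F) := by
    ext y
    simp [G]
  constructor
  · rw [hrange]
    exact hcl
  rw [hrange]
  refine ⟨S.subtypeL.comp (G.equivRange hG.injective hcl).symm.toContinuousLinearMap,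
    fun u hu hLu => ?_⟩
  have h : (G.equivRange hG.injective hcl).symm ⟨L u, hLu⟩ = ⟨u, hu⟩ := by
    rw [ContinuousLinearEquiv.symm_apply_eq]
    rfl
  exact congrArg Subtype.val h

/-- The space `{∇u : u ∈ H¹₀(Ω)}` of gradients. -/
def gradients (Ω : Opens (Rn n)) : Submodule ℝ (L2Vec Ω) :=
  (H10 Ω).map (gradL Ω : H1 Ω →ₗ[ℝ] L2Vec Ω)

theorem grad_mem_gradients {u : H1 Ω} (hu : u ∈ H10 Ω) : grad u ∈ gradients Ω := ⟨u, hu, rfl⟩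

/-- On a bounded open set, an element of `H¹₀(Ω)` depends continuously on its gradient, and the
space of gradients is closed. -/
theorem exists_gradients_inverse (hn : n ≠ 0) (hΩ : Bornology.IsBounded (Ω : Set (Rn n))) :
    IsClosed (gradients Ω : Set (L2Vec Ω)) ∧ ∃ T : gradients Ω →L[ℝ] H1 Ω,
      ∀ u ∈ H10 Ω, ∀ h : grad u ∈ gradients Ω, T ⟨grad u, h⟩ = u := by
  obtain ⟨C, hC0, hC⟩ := exists_norm_toL2_le hn hΩ
  refine exists_inverse_of_bounded_below (Submodule.isClosed_topologicalClosure _) (gradL Ω)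
    (C := C + 1) (by positivity) fun u hu => ?_
  refine le_of_sq_le_sq ?_ (by positivity)
  have h1 := pow_le_pow_left₀ (norm_nonneg _) (hC u hu) 2
  rw [norm_sq_H1, gradL_apply]
  nlinarith [mul_nonneg hC0 (sq_nonneg ‖grad u‖)]

theorem weakDiv_apply (p : L2Vec Ω) (φ : 𝓓(Ω, ℝ)) :
    weakDiv p φ = - inner ℝ p (grad (ofTestFunction φ)) := by
  rw [weakDiv, L2.inner_def]
  congr 1
  refine integral_congr_ae ?_
  filter_upwards [coeFn_grad_ofTestFunction φ] with x hx
  rw [hx]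

/-- A field is divergence free in the sense of distributions iff it is orthogonal to the gradients
of `H¹₀(Ω)`. -/
theorem weakDiv_eq_zero_iff (p : L2Vec Ω) : weakDiv p = 0 ↔ p ∈ (gradients Ω)ᗮ := by
  constructor
  · intro h
    rw [Submodule.mem_orthogonal']
    rintro _ ⟨u, hu, rfl⟩
    have hle : H10 Ω ≤ LinearMap.ker ((innerSL ℝ p).comp (gradL Ω) : H1 Ω →ₗ[ℝ] ℝ) := by
      refine Submodule.topologicalClosure_minimal _ (fun w hw => ?_)
        ((innerSL ℝ p).comp (gradL Ω)).isClosed_ker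
      obtain ⟨φ, rfl⟩ := mem_span_smoothCompact_iff.1 hw
      have := congrFun h φ
      rw [weakDiv_apply, Pi.zero_apply, neg_eq_zero] at this
      exact this
    exact hle hu
  · intro h
    funext φ
    rw [weakDiv_apply, Pi.zero_apply, neg_eq_zero]
    exact (Submodule.mem_orthogonal' _ _).1 h _ (grad_mem_gradients (ofTestFunction_mem_H10 φ))

theorem weakDiv_eq_iff (p q : L2Vec Ω) : weakDiv p = weakDiv q ↔ p - q ∈ (gradients Ω)ᗮ := by
  rw [← weakDiv_eq_zero_iff, funext_iff, funext_iff]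
  refine forall_congr' fun φ => ?_
  rw [weakDiv_apply, weakDiv_apply, weakDiv_apply, inner_sub_left, Pi.zero_apply]
  constructor <;> intro h <;> linarith

theorem trace_eq_zero_iff (u : H1 Ω) : trace u = 0 ↔ u ∈ H10 Ω := by
  rw [trace, Submodule.mkQ_apply, Submodule.Quotient.mk_eq_zero]

end Sobolev

/-! ### Proximal maps and Lagrange multipliers -/

section Proximal

variable {H : Type*} [NormedAddCommGroup H] [InnerProductSpace ℝ H]

/-- `J` is the proximal map of `c⁻¹ g`, expressed by its variational inequality: `c (w - J w)` is a
subgradient of `g` at `J w`. -/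
def IsProx (g : H → ℝ) (c : ℝ) (J : H → H) : Prop :=
  ∀ w y, g (J w) + c * inner ℝ (w - J w) (y - J w) ≤ g y

variable {g : H → ℝ} {c : ℝ} {J : H → H} {K : Submodule ℝ H}

theorem IsProx.firmlyNonexpansive (hJ : IsProx g c J) (hc : 0 < c) : FirmlyNonexpansive J := by
  intro w z
  have h1 := hJ w (J z)
  have h2 := hJ z (J w)
  have h3 : c * inner ℝ ((w - J w) - (z - J z)) (J w - J z) =
      -(c * inner ℝ (w - J w) (J z - J w) + c * inner ℝ (z - J z) (J w - J z)) := by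
    rw [← neg_sub (J w) (J z), inner_neg_right, inner_sub_left]
    ring
  exact nonneg_of_mul_nonneg_right (by rw [h3]; linarith) hc

/-- A saddle point yields a minimizer over the subspace. -/
theorem IsSaddle.le_of_mem {b d : H} (h : IsSaddle K J b d) (hJ : IsProx g c J) {y : H}
    (hy : y ∈ K) : g d ≤ g y := by
  have h1 := hJ (d + b) y
  rw [h.fixed, add_sub_cancel_left,
    (Submodule.mem_orthogonal' _ _).1 h.orth _ (K.sub_mem hy h.mem)] at h1
  linarith

/-- Lagrange multipliers, by separating the strict epigraph of `g` from `K × {g d}`: a minimizer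
`d` of `g` over `K` has a subgradient orthogonal to `K`. -/
theorem exists_subgradient_mem_orthogonal [CompleteSpace H] (hconv : ConvexOn ℝ Set.univ g)
    (hcont : Continuous g) {d : H} (hd : d ∈ K) (hmin : ∀ y ∈ K, g d ≤ g y) :
    ∃ b ∈ Kᗮ, ∀ y, g d + inner ℝ b (y - d) ≤ g y := by
  let s : Set (H × ℝ) := {p | p.1 ∈ Set.univ ∧ g p.1 < p.2}
  let t : Set (H × ℝ) := (K : Set H) ×ˢ {g d}
  have hs : IsOpen s := by
    have : s = {p | g p.1 < p.2} := by ext; simp [s]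
    rw [this]
    exact isOpen_lt (hcont.comp continuous_fst) continuous_snd
  have ht : Convex ℝ t := K.convex.prod (convex_singleton _)
  have hst : Disjoint s t := by
    rw [Set.disjoint_left]
    rintro ⟨y, r⟩ ⟨-, h1⟩ ⟨h2, h3⟩
    rw [Set.mem_singleton_iff] at h3
    exact (h1.trans_eq h3).not_ge (hmin y h2)
  obtain ⟨f, u, hfs, hft⟩ := geometric_hahn_banach_open hconv.convex_strict_epigraph hs ht hst
  have hsplit : ∀ y r, f (y, r) = f (y, 0) + r * f (0, 1) := by
    intro y r
    have : ((y, r) : H × ℝ) = (y, 0) + r • (0, 1) := by simp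
    rw [this, map_add, map_smul, smul_eq_mul]
  set γ := f (0, 1) with hγ
  -- the separating hyperplane is not vertical, as `g` is finite everywhere
  have hγneg : γ < 0 := by
    have h1 := hfs (d, g d + 1) ⟨trivial, by simp⟩
    have h2 := hft (d, g d) ⟨hd, rfl⟩
    rw [hsplit] at h1 h2
    linarith
  -- a linear functional that is bounded below on a subspace vanishes there
  have hK : ∀ y ∈ K, f (y, 0) = 0 := by
    intro y hy
    by_contra hne
    have h := hft (((u - g d * γ - 1) / f (y, 0)) • y, g d) ⟨K.smul_mem _ hy, rfl⟩
    have e : f (((u - g d * γ - 1) / f (y, 0)) • y, 0) = u - g d * γ - 1 := by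
      have : ((((u - g d * γ - 1) / f (y, 0)) • y, 0) : H × ℝ) =
          ((u - g d * γ - 1) / f (y, 0)) • (y, 0) := by simp
      rw [this, map_smul, smul_eq_mul, div_mul_cancel₀ _ hne]
    rw [hsplit, e] at h
    linarith
  let b : H := (InnerProductSpace.toDual ℝ H).symm
    ((-γ)⁻¹ • f.comp (ContinuousLinearMap.inl ℝ H ℝ))
  have hb : ∀ y, inner ℝ b y = (-γ)⁻¹ * f (y, 0) := fun y =>
    InnerProductSpace.toDual_symm_apply.trans rfl
  refine ⟨b, (Submodule.mem_orthogonal' _ _).2 fun y hy => by rw [hb, hK y hy, mul_zero],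
    fun y => ?_⟩
  rw [inner_sub_right, hb, hb, hK d hd, mul_zero, sub_zero]
  have h1 : ∀ r, g y < r → f (y, 0) + r * γ ≤ g d * γ := by
    intro r hr
    have h2 := hfs (y, r) ⟨trivial, hr⟩
    have h3 := hft (d, g d) ⟨hd, rfl⟩
    rw [hsplit] at h2 h3
    rw [hK d hd] at h3
    linarith
  refine le_of_forall_gt_imp_ge_of_dense fun r hr => ?_
  have h2 := h1 r hr
  rw [← sub_nonneg]
  have : r - (g d + (-γ)⁻¹ * f (y, 0)) = (-γ)⁻¹ * (g d * γ - (f (y, 0) + r * γ)) := by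
    have hγ0 := hγneg.ne
    rw [inv_neg, neg_mul, mul_sub, mul_add]
    field_simp
    ring
  rw [this]
  exact mul_nonneg (inv_nonneg.2 (by linarith)) (by linarith)

/-- The minimizer over `K` is the `d` of a saddle point, with the multiplier as `b`. -/
theorem exists_isSaddle_of_isMin [CompleteSpace H] (hJ : IsProx g c J) (hc : 0 < c)
    (hconv : ConvexOn ℝ Set.univ g) (hcont : Continuous g) {d : H} (hd : d ∈ K)
    (hmin : ∀ y ∈ K, g d ≤ g y) : ∃ b d, IsSaddle K J b d := by
  obtain ⟨b, hb, hsub⟩ := exists_subgradient_mem_orthogonal hconv hcont hd hmin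
  refine ⟨c⁻¹ • b, d, hd, Kᗮ.smul_mem _ hb, ?_⟩
  set y := J (d + c⁻¹ • b) with hy
  have h1 := hsub y
  have h2 := hJ (d + c⁻¹ • b) d
  have h3 : c * inner ℝ (d + c⁻¹ • b - y) (d - y) = c * ‖d - y‖ ^ 2 - inner ℝ b (y - d) := by
    rw [show d + c⁻¹ • b - y = (d - y) + c⁻¹ • b by abel, inner_add_left,
      real_inner_self_eq_norm_sq, real_inner_smul_left, ← neg_sub y d, inner_neg_right, mul_add,
      mul_neg, mul_neg, mul_inv_cancel_left₀ hc.ne']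
    ring
  rw [← hy, h3] at h2
  have h4 : ‖d - y‖ ^ 2 ≤ 0 := by
    by_contra hne
    have := mul_pos hc (not_le.1 hne)
    linarith
  have h5 : ‖d - y‖ = 0 := by nlinarith [sq_nonneg ‖d - y‖]
  exact (sub_eq_zero.1 (norm_eq_zero.1 h5)).symm

end Proximal

/-! ### Shrinkage of vectors -/

section Shrink

variable {n : ℕ}

theorem shrink_eq (t : ℝ) (w : Rn n) : shrink t w = (max (‖w‖ - t) 0 * ‖w‖⁻¹) • w := by
  rw [shrink]
  split_ifs with h
  · rw [h, smul_zero]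
  · rw [smul_smul]

theorem norm_shrink (t : ℝ) {w : Rn n} (hw : w ≠ 0) : ‖shrink t w‖ = max (‖w‖ - t) 0 := by
  have h : ‖w‖ ≠ 0 := norm_ne_zero_iff.2 hw
  rw [shrink_eq, norm_smul, Real.norm_eq_abs, abs_mul, abs_of_nonneg (le_max_right _ _), abs_inv,
    abs_norm, inv_mul_cancel_right₀ h]

theorem norm_shrink_le (t : ℝ) (w : Rn n) : ‖shrink t w‖ ≤ ‖w‖ + |t| := by
  by_cases hw : w = 0
  · simp [hw, shrink]
  · rw [norm_shrink t hw]
    exact max_le (by linarith [neg_abs_le t]) (by positivity)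

theorem norm_sub_shrink_le {t : ℝ} (ht : 0 ≤ t) (w : Rn n) : ‖w - shrink t w‖ ≤ t := by
  by_cases hw : w = 0
  · simp [hw, shrink, ht]
  have h : 0 < ‖w‖ := norm_pos_iff.2 hw
  have e : w - shrink t w = (1 - max (‖w‖ - t) 0 * ‖w‖⁻¹) • w := by
    rw [shrink_eq, sub_smul, one_smul]
  rw [e, norm_smul, Real.norm_eq_abs, ← abs_norm w, ← abs_mul, abs_norm, sub_mul, one_mul,
    inv_mul_cancel_right₀ h.ne']
  rcases le_total (‖w‖ - t) 0 with h1 | h1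
  · rw [max_eq_right h1, sub_zero, abs_norm]
    linarith
  · rw [max_eq_left h1, sub_sub_cancel, abs_of_nonneg ht]

theorem inner_sub_shrink {t : ℝ} (w : Rn n) :
    inner ℝ (w - shrink t w) (shrink t w) = t * ‖shrink t w‖ := by
  by_cases hw : w = 0
  · simp [hw, shrink]
  have h : ‖w‖ ≠ 0 := norm_ne_zero_iff.2 hw
  rw [norm_shrink t hw, inner_sub_left, real_inner_self_eq_norm_sq, norm_shrink t hw, shrink_eq,
    inner_smul_right, real_inner_self_eq_norm_sq]
  rcases le_total (‖w‖ - t) 0 with h1 | h1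
  · rw [max_eq_right h1]
    simp
  · rw [max_eq_left h1]
    field_simp
    ring

/-- `w - shrink t w` is a subgradient of `t |·|` at `shrink t w`. -/
theorem shrink_subgradient {t : ℝ} (ht : 0 ≤ t) (w y : Rn n) :
    t * ‖shrink t w‖ + inner ℝ (w - shrink t w) (y - shrink t w) ≤ t * ‖y‖ := by
  rw [inner_sub_right, inner_sub_shrink]
  have := (real_inner_le_norm (w - shrink t w) y).trans
    (mul_le_mul_of_nonneg_right (norm_sub_shrink_le ht w) (norm_nonneg y))
  linarith

/-- If `b` is a subgradient of `t |·|` at `p`, then `b = t p / |p|`, unless `p = 0` and `t ≠ 0`. -/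
theorem eq_smul_of_shrink_add_eq {t : ℝ} (ht : 0 ≤ t) {p b : Rn n} (h : shrink t (p + b) = p)
    (hp : p = 0 → t = 0) : b = t • (‖p‖⁻¹ • p) := by
  have h1 := norm_sub_shrink_le ht (p + b)
  have h2 := inner_sub_shrink (t := t) (p + b)
  rw [h, add_sub_cancel_left] at h1 h2
  by_cases hp0 : p = 0
  · rw [hp hp0] at h1 ⊢
    rw [zero_smul]
    exact norm_le_zero_iff.1 h1
  have hpn : ‖p‖ ≠ 0 := norm_ne_zero_iff.2 hp0
  -- equality in the Cauchy–Schwarz inequality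
  have h3 : ‖b - t • (‖p‖⁻¹ • p)‖ ^ 2 = ‖b‖ ^ 2 - t ^ 2 := by
    rw [norm_sub_sq_real, inner_smul_right, inner_smul_right, h2, norm_smul, norm_smul, norm_inv,
      norm_norm, inv_mul_cancel₀ hpn, Real.norm_eq_abs, abs_of_nonneg ht]
    field_simp
    ring
  have h4 : ‖b - t • (‖p‖⁻¹ • p)‖ ^ 2 ≤ 0 := by
    rw [h3]
    have := pow_le_pow_left₀ (norm_nonneg b) h1 2
    linarith
  have h5 : ‖b - t • (‖p‖⁻¹ • p)‖ = 0 := by nlinarith [sq_nonneg ‖b - t • (‖p‖⁻¹ • p)‖]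
  exact sub_eq_zero.1 (norm_eq_zero.1 h5)

theorem measurable_shrink : Measurable fun q : ℝ × Rn n => shrink q.1 q.2 := by
  simp only [shrink_eq]
  exact (((measurable_snd.norm.sub measurable_fst).max measurable_const).mul
    measurable_snd.norm.inv).smul measurable_snd

end Shrink

/-! ### The weighted norm and its proximal map -/

section WeightedNorm

variable {n : ℕ} {Ω : Opens (Rn n)}

/-- `∫_Ω a |p|` for a vector field `p ∈ (L²(Ω))ⁿ`. -/
def weightedNorm (a : L2 Ω) (p : L2Vec Ω) : ℝ := ∫ x, a x * ‖p x‖ ∂(vol Ω)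

theorem integrable_weight_mul_norm (a : L2 Ω) (p : L2Vec Ω) :
    Integrable (fun x => a x * ‖p x‖) (vol Ω) :=
  memLp_one_iff_integrable.1 ((Lp.memLp p).norm.mul (Lp.memLp a))

theorem continuous_weightedNorm (a : L2 Ω) : Continuous (weightedNorm a) := by
  have hn : LipschitzWith 1 (norm : Rn n → ℝ) := lipschitzWith_one_norm
  have h : weightedNorm a = fun p => inner ℝ (hn.compLp norm_zero p) a := by
    funext p
    rw [L2.inner_def]
    refine integral_congr_ae ?_
    filter_upwards [hn.coeFn_compLp norm_zero p] with x hx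
    rw [hx]
    rfl
  rw [h]
  exact (hn.continuous_compLp norm_zero).inner continuous_const

theorem convexOn_weightedNorm {a : L2 Ω} (ha : ∀ᵐ x ∂(vol Ω), 0 ≤ a x) :
    ConvexOn ℝ Set.univ (weightedNorm a) := by
  refine ⟨convex_univ, fun p _ q _ s t hs ht _ => ?_⟩
  have e : s • weightedNorm a p + t • weightedNorm a q =
      ∫ x, (s * (a x * ‖p x‖) + t * (a x * ‖q x‖)) ∂(vol Ω) := by
    rw [integral_add ((integrable_weight_mul_norm a p).const_mul s)
      ((integrable_weight_mul_norm a q).const_mul t), integral_const_mul, integral_const_mul]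
    rfl
  rw [e]
  refine integral_mono_ae (integrable_weight_mul_norm a _)
    (((integrable_weight_mul_norm a p).const_mul s).add
      ((integrable_weight_mul_norm a q).const_mul t)) ?_
  filter_upwards [ha, Lp.coeFn_add (s • p) (t • q), Lp.coeFn_smul s p, Lp.coeFn_smul t q]
    with x h0 h1 h2 h3
  rw [h1, Pi.add_apply, h2, h3, Pi.smul_apply, Pi.smul_apply]
  have := norm_add_le (s • p x) (t • q x)
  rw [norm_smul, norm_smul, Real.norm_of_nonneg hs, Real.norm_of_nonneg ht] at this
  nlinarith [mul_le_mul_of_nonneg_left this h0]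

theorem memLp_shrink (lam : ℝ) (a : L2 Ω) (p : L2Vec Ω) :
    MemLp (fun x => shrink (a x / lam) (p x)) 2 (vol Ω) := by
  have h1 : MemLp (fun x => a x / lam) 2 (vol Ω) := by
    simpa only [div_eq_inv_mul] using (Lp.memLp a).const_mul lam⁻¹
  refine ((Lp.memLp p).norm.add h1.norm).of_le ?_ ?_
  · exact (measurable_shrink.comp_aemeasurable (h1.aestronglyMeasurable.aemeasurable.prodMk
      (Lp.memLp p).aestronglyMeasurable.aemeasurable)).aestronglyMeasurable
  · refine Eventually.of_forall fun x => ?_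
    rw [Real.norm_of_nonneg (by simp only [Pi.add_apply]; positivity)]
    exact norm_shrink_le _ _

/-- Shrinkage of vector fields, shifted by `q`: the map `w ↦ shrink (a / lam) (w + q) - q` on
`(L²(Ω))ⁿ`. -/
def shrinkL2 (lam : ℝ) (a : L2 Ω) (q w : L2Vec Ω) : L2Vec Ω :=
  (memLp_shrink lam a (w + q)).toLp _ - q

theorem coeFn_shrinkL2_add (lam : ℝ) (a : L2 Ω) (q w : L2Vec Ω) :
    (shrinkL2 lam a q w + q : L2Vec Ω) =ᵐ[vol Ω] fun x => shrink (a x / lam) (w x + q x) := by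
  rw [shrinkL2, sub_add_cancel]
  filter_upwards [(memLp_shrink lam a (w + q)).coeFn_toLp, Lp.coeFn_add w q] with x h1 h2
  rw [h1, h2, Pi.add_apply]

theorem coeFn_shrinkL2 (lam : ℝ) (a : L2 Ω) (q w : L2Vec Ω) :
    shrinkL2 lam a q w =ᵐ[vol Ω] fun x => shrink (a x / lam) (w x + q x) - q x := by
  filter_upwards [coeFn_shrinkL2_add lam a q w, Lp.coeFn_add (shrinkL2 lam a q w) q] with x h1 h2
  rw [← h1, h2, Pi.add_apply, add_sub_cancel_right]

/-- The shifted shrinkage is the proximal map of `p ↦ lam⁻¹ ∫_Ω a |p + q|`. -/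
theorem isProx_shrinkL2 {lam : ℝ} (hlam : 0 < lam) {a : L2 Ω} (ha : ∀ᵐ x ∂(vol Ω), 0 ≤ a x)
    (q : L2Vec Ω) : IsProx (fun p => weightedNorm a (p + q)) lam (shrinkL2 lam a q) := by
  intro w y
  set s := shrinkL2 lam a q w
  have e : weightedNorm a (s + q) + lam * inner ℝ (w - s) (y - s) =
      ∫ x, (a x * ‖(s + q) x‖ + lam * inner ℝ ((w - s) x) ((y - s) x)) ∂(vol Ω) := by
    rw [integral_add (integrable_weight_mul_norm a _)
      ((L2.integrable_inner _ _).const_mul lam), integral_const_mul, L2.inner_def]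
    rfl
  change weightedNorm a (s + q) + lam * inner ℝ (w - s) (y - s) ≤ weightedNorm a (y + q)
  rw [e]
  refine integral_mono_ae ((integrable_weight_mul_norm a _).add
    ((L2.integrable_inner _ _).const_mul lam)) (integrable_weight_mul_norm a _) ?_
  filter_upwards [ha, coeFn_shrinkL2_add lam a q w, Lp.coeFn_add s q, Lp.coeFn_add y q,
    Lp.coeFn_sub w s, Lp.coeFn_sub y s] with x h0 h1 h2 h3 h4 h5
  have h := shrink_subgradient (div_nonneg h0 hlam.le) (w x + q x) (y x + q x)
  rw [← h1, h2, Pi.add_apply, add_sub_add_right_eq_sub, add_sub_add_right_eq_sub] at h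
  rw [h2, h3, h4, h5]
  simp only [Pi.add_apply, Pi.sub_apply]
  have h' := mul_le_mul_of_nonneg_left h hlam.le
  have c1 : ∀ r, lam * (a x / lam * r) = a x * r := fun r => by field_simp
  rwa [mul_add, c1, c1] at h'

end WeightedNorm

/-! ### The algorithm as a splitting iteration -/

section Bregman

variable {n : ℕ} {Ω : Opens (Rn n)} {lam : ℝ} {a : L2 Ω} {uf : H1 Ω} {b0 d0 : L2Vec Ω}
  {b d : ℕ → L2Vec Ω} {u : ℕ → H1 Ω}

theorem grad_add (u v : H1 Ω) : grad (u + v) = grad u + grad v := rfl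

theorem grad_sub (u v : H1 Ω) : grad (u - v) = grad u - grad v := rfl

/-- The weak solutions in `H¹₀(Ω)` of `Δu = ∇ · p` are those `u` whose gradient is the projection
of `p` onto the space of gradients. -/
theorem weakDiv_grad_eq_iff [(gradients Ω).HasOrthogonalProjection] {u : H1 Ω} (hu : u ∈ H10 Ω)
    (p : L2Vec Ω) : weakDiv (grad u) = weakDiv p ↔ grad u = (gradients Ω).starProjection p := by
  rw [eq_comm, weakDiv_eq_iff]
  constructor
  · intro h
    exact (Submodule.eq_starProjection_of_mem_orthogonal (grad_mem_gradients hu) h).symm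
  · intro h
    rw [h]
    exact (gradients Ω).sub_starProjection_mem_orthogonal p

/-- A run of the algorithm, written as the splitting iteration for the subspace of gradients and
the shifted shrinkage. -/
theorem isBregmanRun_iff [(gradients Ω).HasOrthogonalProjection] :
    IsBregmanRun lam a uf b0 d0 b d u ↔ b 0 = b0 ∧ d 0 = d0 ∧ (∀ k, u (k + 1) ∈ H10 Ω) ∧
      (∀ k, grad (u (k + 1)) = (gradients Ω).starProjection (d k - b k)) ∧
      (∀ k, d (k + 1) = shrinkL2 lam a (grad uf)
        (b k + (gradients Ω).starProjection (d k - b k))) ∧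
      ∀ k, b (k + 1) = b k + (gradients Ω).starProjection (d k - b k) - d (k + 1) := by
  have hstep : ∀ k, (∀ᵐ x ∂(vol Ω), d (k + 1) x =
      shrink (a x / lam) (grad (u (k + 1)) x + grad uf x + b k x) - grad uf x) ↔
      d (k + 1) = shrinkL2 lam a (grad uf) (b k + grad (u (k + 1))) := by
    intro k
    have h : ∀ᵐ x ∂(vol Ω), shrinkL2 lam a (grad uf) (b k + grad (u (k + 1))) x =
        shrink (a x / lam) (grad (u (k + 1)) x + grad uf x + b k x) - grad uf x := by
      filter_upwards [coeFn_shrinkL2 lam a (grad uf) (b k + grad (u (k + 1))),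
        Lp.coeFn_add (b k) (grad (u (k + 1)))] with x h1 h2
      rw [h1, h2, Pi.add_apply, add_assoc, add_comm (b k x)]
    constructor
    · intro hd
      refine Lp.ext ?_
      filter_upwards [hd, h] with x h1 h2
      rw [h1, h2]
    · intro hd
      rw [hd]
      exact h
  constructor
  · intro h
    have hu : ∀ k, u (k + 1) ∈ H10 Ω := fun k => (trace_eq_zero_iff _).1 (h.boundary k)
    have hg := fun k => (weakDiv_grad_eq_iff (hu k) _).1 (h.poisson k)
    refine ⟨h.init_b, h.init_d, hu, hg, fun k => ?_, fun k => ?_⟩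
    · rw [← hg k]
      exact (hstep k).1 (h.step_d k)
    · rw [← hg k]
      exact h.step_b k
  · rintro ⟨h1, h2, hu, hg, h3, h4⟩
    refine ⟨h1, h2, fun k => (weakDiv_grad_eq_iff (hu k) _).2 (hg k),
      fun k => (trace_eq_zero_iff _).2 (hu k), fun k => (hstep k).2 ?_, fun k => ?_⟩
    · rw [hg k]
      exact h3 k
    · rw [hg k]
      exact h4 k

theorem exists_isBregmanRun [(gradients Ω).HasOrthogonalProjection] (lam : ℝ) (a : L2 Ω)
    (uf : H1 Ω) (b0 d0 : L2Vec Ω) :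
    ∃ (b d : ℕ → L2Vec Ω) (u : ℕ → H1 Ω), IsBregmanRun lam a uf b0 d0 b d u := by
  set P := (gradients Ω).starProjection
  have hsolve : ∀ p : L2Vec Ω, ∃ u : H1 Ω, u ∈ H10 Ω ∧ grad u = P p := fun p =>
    (gradients Ω).starProjection_apply_mem p
  choose U hU hgU using hsolve
  let J := shrinkL2 lam a (grad uf)
  let step : L2Vec Ω × L2Vec Ω → L2Vec Ω × L2Vec Ω := fun p =>
    (p.1 + P (p.2 - p.1) - J (p.1 + P (p.2 - p.1)), J (p.1 + P (p.2 - p.1)))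
  let s : ℕ → L2Vec Ω × L2Vec Ω := fun k => step^[k] (b0, d0)
  have hs : ∀ k, s (k + 1) = step (s k) := fun k => Function.iterate_succ_apply' step k _
  -- the term `u 0` is not constrained
  refine ⟨fun k => (s k).1, fun k => (s k).2, fun k => U ((s (k - 1)).2 - (s (k - 1)).1),
    isBregmanRun_iff.2 ⟨rfl, rfl, fun k => hU _, fun k => hgU _, fun k => ?_, fun k => ?_⟩⟩
  · rw [hs]
  · rw [hs]

/-- The least gradient problem as a minimization over the subspace of gradients. -/
theorem isMinimizer_iff {f : HHalf Ω} (huf : trace uf = f) (v : H1 Ω) :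
    IsMinimizer a f (v + uf) ↔ v ∈ H10 Ω ∧ ∀ p ∈ gradients Ω,
      weightedNorm a (grad v + grad uf) ≤ weightedNorm a (p + grad uf) := by
  have htr : ∀ w : H1 Ω, trace (w + uf) = f ↔ w ∈ H10 Ω := fun w => by
    rw [map_add, huf, add_eq_right, trace_eq_zero_iff]
  refine and_congr (htr v) ⟨fun h p hp => ?_, fun h w hw => ?_⟩
  · obtain ⟨w, hw, rfl⟩ := hp
    exact h (w + uf) ((htr w).2 hw)
  · have hw' : w - uf ∈ H10 Ω := (htr _).1 (by rwa [sub_add_cancel])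
    have := h _ (grad_mem_gradients hw')
    rwa [grad_sub, sub_add_cancel] at this

theorem WeakTendsto.sub {X : Type*} [NormedAddCommGroup X] [NormedSpace ℝ X] {s t : ℕ → X}
    {l m : X} (hs : WeakTendsto s l) (ht : WeakTendsto t m) :
    WeakTendsto (fun k => s k - t k) (l - m) := by
  rw [weakTendsto_iff] at *
  intro φ
  simpa only [map_sub] using (hs φ).sub (ht φ)

end Bregman

end LeastGradient

end

theorem theorem1p1 {n : ℕ} (hn : 2 ≤ n)
    (Ω : TopologicalSpace.Opens (LeastGradient.Rn n))
    (hΩ : Bornology.IsBounded (Ω : Set (LeastGradient.Rn n)))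
    (lam : ℝ) (hlam : 0 < lam)
    (a : LeastGradient.L2 Ω) (ha : ∀ᵐ x ∂(LeastGradient.vol Ω), 0 ≤ a x)
    (f : LeastGradient.HHalf Ω)
    (hmin : ∃ v : LeastGradient.H1 Ω, LeastGradient.IsMinimizer a f v)
    (uf : LeastGradient.H1 Ω) (huf : LeastGradient.trace uf = f)
    (b0 d0 : LeastGradient.L2Vec Ω) :
    -- the algorithm can be carried out
    (∃ (b d : ℕ → LeastGradient.L2Vec Ω) (u : ℕ → LeastGradient.H1 Ω),
      LeastGradient.IsBregmanRun lam a uf b0 d0 b d u) ∧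
    -- and whatever it produces converges
    ∀ (b d : ℕ → LeastGradient.L2Vec Ω) (u : ℕ → LeastGradient.H1 Ω),
      LeastGradient.IsBregmanRun lam a uf b0 d0 b d u →
      ∃ (bhat dhat : LeastGradient.L2Vec Ω) (uhat : LeastGradient.H1 Ω),
        LeastGradient.WeakTendsto b bhat ∧
        LeastGradient.WeakTendsto d dhat ∧
        LeastGradient.WeakTendsto u uhat ∧
        Tendsto (fun k => LeastGradient.grad (u (k + 1)) - d k) atTop (𝓝 0) ∧
        Summable (fun k => ‖LeastGradient.grad (u (k + 1)) - d k‖ ^ 2) ∧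
        LeastGradient.IsMinimizer a f (uhat + uf) ∧
        dhat = LeastGradient.grad uhat ∧
        LeastGradient.weakDiv bhat = 0 ∧
        ∀ᵐ x ∂(LeastGradient.vol Ω),
          ¬ (LeastGradient.grad (uhat + uf) x = 0 ∧ a x ≠ 0) →
          bhat x = lam⁻¹ • (a x • (‖LeastGradient.grad (uhat + uf) x‖⁻¹ •
            LeastGradient.grad (uhat + uf) x)) := by
  obtain ⟨hclosed, T, hT⟩ := LeastGradient.exists_gradients_inverse (Ω := Ω) (by omega) hΩ
  have : CompleteSpace (LeastGradient.gradients Ω) := hclosed.completeSpace_coe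
  refine ⟨LeastGradient.exists_isBregmanRun lam a uf b0 d0, fun b d u hrun => ?_⟩
  obtain ⟨-, -, hu, hg, hd, hb⟩ := LeastGradient.isBregmanRun_iff.1 hrun
  have hJ := LeastGradient.isProx_shrinkL2 hlam ha (LeastGradient.grad uf)
  have hsaddle : ∃ b d, LeastGradient.IsSaddle (LeastGradient.gradients Ω)
      (LeastGradient.shrinkL2 lam a (LeastGradient.grad uf)) b d := by
    obtain ⟨v, hv⟩ := hmin
    rw [← sub_add_cancel v uf, LeastGradient.isMinimizer_iff huf] at hv
    exact LeastGradient.exists_isSaddle_of_isMin hJ hlam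
      ((LeastGradient.convexOn_weightedNorm ha).translate_left _)
      ((LeastGradient.continuous_weightedNorm a).comp (continuous_id.add continuous_const))
      (LeastGradient.grad_mem_gradients hv.1) hv.2
  obtain ⟨hsum, bh, dh, hs, hbw, hdw⟩ :=
    LeastGradient.splitting_converges (hJ.firmlyNonexpansive hlam) hsaddle hd hb
  simp only [← hg] at hsum
  obtain ⟨uh, huh, hdh⟩ := hs.mem
  change LeastGradient.grad uh = dh at hdh
  subst hdh
  have huw : LeastGradient.WeakTendsto u uh := by
    have h := (hdw.sub hbw).map (T.comp (LeastGradient.gradients Ω).orthogonalProjectionOnto)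
    have hproj : (LeastGradient.gradients Ω).starProjection (LeastGradient.grad uh - bh) =
        LeastGradient.grad uh := by
      rw [map_sub, (LeastGradient.gradients Ω).starProjection_eq_self_iff.2 hs.mem,
        (LeastGradient.gradients Ω).starProjection_apply_eq_zero_iff.2 hs.orth, sub_zero]
    -- `T` recovers an element of `H¹₀(Ω)` from its gradient
    have hrec : ∀ (p : LeastGradient.L2Vec Ω) (v : LeastGradient.H1 Ω),
        v ∈ LeastGradient.H10 Ω → (LeastGradient.gradients Ω).starProjection p =
          LeastGradient.grad v →
        T.comp (LeastGradient.gradients Ω).orthogonalProjectionOnto p = v := by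
      intro p v hv hp
      rw [← hT v hv (LeastGradient.grad_mem_gradients hv), ContinuousLinearMap.comp_apply]
      exact congrArg T (Subtype.ext hp)
    rw [hrec _ uh huh hproj] at h
    simp only [fun k => hrec _ (u (k + 1)) (hu k) (hg k).symm] at h
    exact (tendsto_add_atTop_iff_nat 1).1 h
  refine ⟨bh, LeastGradient.grad uh, uh, hbw, hdw, huw, ?_, hsum, ?_, rfl,
    (LeastGradient.weakDiv_eq_zero_iff bh).2 hs.orth, ?_⟩
  · rw [tendsto_zero_iff_norm_tendsto_zero]
    simpa [Real.sqrt_sq] using hsum.tendsto_atTop_zero.sqrt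
  · exact (LeastGradient.isMinimizer_iff huf uh).2 ⟨huh, fun p hp => hs.le_of_mem hJ hp⟩
  · have hfix := LeastGradient.coeFn_shrinkL2_add lam a (LeastGradient.grad uf)
      (LeastGradient.grad uh + bh)
    rw [hs.fixed, ← LeastGradient.grad_add] at hfix
    filter_upwards [ha, hfix, Lp.coeFn_add (LeastGradient.grad uh) bh,
      Lp.coeFn_add (LeastGradient.grad uh) (LeastGradient.grad uf)] with x h0 h1 h2 h3 hx
    rw [← LeastGradient.grad_add] at h3
    have h4 : LeastGradient.shrink (a x / lam) (LeastGradient.grad (uh + uf) x + bh x) =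
        LeastGradient.grad (uh + uf) x := by
      conv_rhs => rw [h1, h2]
      rw [h3, Pi.add_apply, Pi.add_apply, add_right_comm]
    rw [LeastGradient.eq_smul_of_shrink_add_eq (div_nonneg h0 hlam.le) h4 fun hp => ?_,
      div_eq_inv_mul, mul_smul]
    have : a x = 0 := not_not.1 fun hne => hx ⟨hp, hne⟩
    rw [this, zero_div]
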